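/- **Online set cover with repetitions.** A family $\mathcal S$ of $m$ subsets of an $n$-element ground set $X$ with costs $c_S\ge 0$ is known in advance. Elements of $X$ arrive one by one, each possibly several times. After each arrival, every element must be contained in at least as many different chosen sets as the number of times it has arrived; chosen sets cannot be given back. Only sequences that have a feasible cover are considered, and the goal is to minimize the total cost of the chosen sets. **Admission control to minimize rejections.** Edges $e$ with integer capacities $c_e>0$ are given, and requests, each of which is a set of edges with a positive cost, arrive one by one. At each moment each edge $e$ may be used by at most $c_e$ accepted requests. An accepted request may be rejected later, but a rejected one stays rejected. The goal is to minimize the total cost of the rejected requests. In the simple-path form of the problem the edges are those of a directed graph and each request is the edge set of a simple directed path. A randomized online algorithm is a probability distribution over deterministic online algorithms, each of which always maintains a feasible solution. It is $\beta$-competitive if on each input sequence (fixed in advance) its expected cost is at most $\beta$ times the optimal offline cost. **Theorem.** 1. (Reduction.) Let all $c_S$ be positive, and let $P>0$ satisfy $P\ge c_S$ for all $S$ (for unit costs one may take $P=1$). Take one edge $e_j$ for each $j\in X$, with capacity equal to the number of sets that contain $j$ (capacity $1$ if there is no such set), so that all capacities are at most $m$ if $m\ge1$. To a sequence $\sigma$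 of elements associate the request sequence $\rho(\sigma)$ that consists first of the requests $\{e_j : j\in S\}$ of cost $c_S$, for all $S\in\mathcal S$, and then of the request $\{e_j\}$ of cost $P$ for each element $j$ of $\sigma$, in order. Then for each $\sigma$ that has a feasible cover the optimal offline costs of $\sigma$ and of $\rho(\sigma)$ are equal. Moreover, for each randomized online admission control algorithm $A$ on this network (defined at least for the requests that occur here) there is a randomized online set cover algorithm $B$ whose expected cost on each such $\sigma$ is at most the expected cost of $A$ on $\rho(\sigma)$; in particular, if $A$ is $\beta$-competitive, then so is $B$. Thus set cover with repetitions with $n$ elements and $m$ sets reduces to admission control on $n$ edges with capacities at most $m$. 2. (Simple paths.) With additional edges, the same holds for the simple-path form: there is a finite directed graph with at most $3n$ edges, with capacities at most $m$ if $m\ge1$, which contains distinct edges $e_j$ ($j\in X$) of the capacities given in 1, and for each $S\in\mathcal S$ a simple path that contains $e_j$ if and only if $j\in S$, such that all claims of 1 hold when the request for $S$ is replaced by this path. 3. (Unit costs.) There is an absolute constant $C$ such that for all $n,m$ and every instance with all costs equal to $1$ there is a randomized online algorithm for set cover with repetitions that is $C\log(m+1)\log(n+1)$-competitive; that is, it is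 $O(\log m\log n)$-competitive when $m,n\ge 2$. 4. (Weighted case.) There is an absolute constant $C$ such that for all $n,m$ and every instance with non-negative costs there is a randomized online algorithm for set cover with repetitions that is $C\log^2(mn+1)$-competitive; that is, it is $O(\log^2(mn))$-competitive when $mn\ge 2$. -/

import Mathlib

open MeasureTheory

noncomputable section

/-! ### Online set cover with repetitions -/

/-- A weighted family of `m` subsets of a ground set of `n` elements. -/
structure SetCover (n m : ℕ) where
  sets : Fin m → Finset (Fin n)
  cost : Fin m → ℝ
  cost_nonneg : ∀ S, 0 ≤ cost S

namespace SetCover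

variable {n m : ℕ} (I : SetCover n m)

/-- The number of sets of the subfamily `T` that contain the element `j`. -/
def cover (T : Finset (Fin m)) (j : Fin n) : ℕ :=
  (T.filter fun S => j ∈ I.sets S).card

/-- `T` covers every element by as many different sets as the number of times it occurs in the
sequence `σ`. -/
def Covers (T : Finset (Fin m)) (σ : List (Fin n)) : Prop :=
  ∀ j, σ.count j ≤ I.cover T j

/-- The sequence `σ` of elements has a feasible cover. -/
def Coverable (σ : List (Fin n)) : Prop := ∃ T, I.Covers T σ

def totalCost (T : Finset (Fin m)) : ℝ := ∑ S ∈ T, I.cost S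

/-- The offline optimum: the least total cost of a cover of `σ`. -/
def opt (σ : List (Fin n)) : ℝ := sInf (I.totalCost '' {T | I.Covers T σ})

/-- A deterministic online algorithm. It knows the instance in advance; `chosen σ` is the
subfamily that it has bought after the elements of `σ` have arrived, one by one. Sets are never
given back, and each sequence that can be covered is covered at each moment. -/
structure Algorithm where
  chosen : List (Fin n) → Finset (Fin m)
  mono : ∀ σ j, chosen σ ⊆ chosen (σ ++ [j])
  covers : ∀ σ, I.Coverable σ → I.Covers (chosen σ) σ

/-- A randomized online algorithm: a random deterministic one. -/
structure RandAlgorithm where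
  Ω : Type
  [measurableSpace : MeasurableSpace Ω]
  μ : Measure Ω
  [isProbabilityMeasure : IsProbabilityMeasure μ]
  alg : Ω → I.Algorithm
  measurable_chosen : ∀ σ T, MeasurableSet {ω | (alg ω).chosen σ = T}

attribute [instance] RandAlgorithm.measurableSpace RandAlgorithm.isProbabilityMeasure

variable {I}

/-- The expected cost of the sets bought on the sequence `σ`. -/
def RandAlgorithm.expCost (B : I.RandAlgorithm) (σ : List (Fin n)) : ℝ :=
  ∫ ω, I.totalCost ((B.alg ω).chosen σ) ∂B.μ

/-- `B` is `β`-competitive (the sequence of elements is fixed before the random choices). -/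
def RandAlgorithm.IsCompetitive (B : I.RandAlgorithm) (β : ℝ) : Prop :=
  ∀ σ, I.Coverable σ → B.expCost σ ≤ β * I.opt σ

end SetCover

/-! ### Admission control to minimize rejections -/

/-- A request: the set of edges that it uses, and its cost. -/
structure Request (E : Type) where
  edges : Finset E
  cost : ℝ

/-- Edges with positive integer capacities. -/
structure Network (E : Type) where
  cap : E → ℕ
  cap_pos : ∀ e, 0 < cap e

namespace Network

variable {E : Type} (N : Network E)

open Classical in
/-- The number of accepted requests of `ρ` that use the edge `e`, when the requests with positions
in `R` are rejected and the other ones are accepted. -/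
def load (ρ : List (Request E)) (R : Finset ℕ) (e : E) : ℕ :=
  (Finset.univ.filter fun i : Fin ρ.length => (i : ℕ) ∉ R ∧ e ∈ (ρ.get i).edges).card

/-- Rejecting the requests with positions in `R` respects all capacities. -/
def Feasible (ρ : List (Request E)) (R : Finset ℕ) : Prop :=
  ∀ e, load ρ R e ≤ N.cap e

/-- The total cost of the rejected requests. -/
def rejCost (ρ : List (Request E)) (R : Finset ℕ) : ℝ :=
  ∑ i : Fin ρ.length, if (i : ℕ) ∈ R then (ρ.get i).cost else 0

/-- The offline optimum: the least total cost of rejected requests in a feasible solution. -/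
def opt (ρ : List (Request E)) : ℝ := sInf (rejCost ρ '' {R | N.Feasible ρ R})

/-- A deterministic online algorithm for request sequences with terms in the class `L`.
`rejected ρ` is the set of positions of the requests rejected so far, after the requests of `ρ`
have arrived, one by one. An accepted request may be rejected later (preemption), but a rejected
request stays rejected. -/
structure Algorithm (L : Set (Request E)) where
  rejected : List (Request E) → Finset ℕ
  arrived : ∀ ρ, (∀ r ∈ ρ, r ∈ L) → ∀ i ∈ rejected ρ, i < ρ.length
  mono : ∀ ρ r, (∀ r' ∈ ρ ++ [r], r' ∈ L) → rejected ρ ⊆ rejected (ρ ++ [r])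
  feasible : ∀ ρ, (∀ r ∈ ρ, r ∈ L) → N.Feasible ρ (rejected ρ)

/-- A randomized online algorithm: a random deterministic one. -/
structure RandAlgorithm (L : Set (Request E)) where
  Ω : Type
  [measurableSpace : MeasurableSpace Ω]
  μ : Measure Ω
  [isProbabilityMeasure : IsProbabilityMeasure μ]
  alg : Ω → N.Algorithm L
  measurable_rejected : ∀ ρ, (∀ r ∈ ρ, r ∈ L) → ∀ R,
    MeasurableSet {ω | (alg ω).rejected ρ = R}

attribute [instance] RandAlgorithm.measurableSpace RandAlgorithm.isProbabilityMeasure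

variable {N} {L : Set (Request E)}

/-- The expected cost of the requests of `ρ` that are rejected. -/
def RandAlgorithm.expCost (A : N.RandAlgorithm L) (ρ : List (Request E)) : ℝ :=
  ∫ ω, rejCost ρ ((A.alg ω).rejected ρ) ∂A.μ

def RandAlgorithm.IsCompetitive (A : N.RandAlgorithm L) (β : ℝ) : Prop :=
  ∀ ρ, (∀ r ∈ ρ, r ∈ L) → A.expCost ρ ≤ β * N.opt ρ

end Network

/-- The edges of a directed graph. -/
abbrev Digraph.Edge {V : Type} (G : Digraph V) : Type := {p : V × V // G.Adj p.1 p.2}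

/-- `T` is the edge set of a simple directed path of `G`; the path is given by the list `l` of its
vertices, and its edges join the consecutive members of `l`. -/
def Digraph.IsSimplePath {V : Type} (G : Digraph V) (T : Finset G.Edge) : Prop :=
  ∃ l : List V, l ≠ [] ∧ l.Nodup ∧ l.IsChain G.Adj ∧
    ∀ e : G.Edge, e ∈ T ↔ [e.1.1, e.1.2] <:+: l

/-! ### The reduction -/

namespace SetCover

variable {n m : ℕ} (I : SetCover n m)

/-- One edge for each element `j`, whose capacity is the number of sets that contain `j`.
(Capacities have to be positive, so an element that lies in no set, and which therefore is
never requested, gets an edge of capacity one.) -/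
def network : Network (Fin n) where
  cap j := max 1 (I.cover Finset.univ j)
  cap_pos _ := lt_of_lt_of_le Nat.zero_lt_one (le_max_left _ _)

variable {E : Type} (setEdges : Fin m → Finset E) (elemEdges : Fin n → Finset E)

/-- The request sequence made from a sequence `σ` of elements. First phase: each set `S` gives a
request for `setEdges S`, of the cost of `S`. Second phase: each element `j` of `σ` gives a
request for `elemEdges j`, of cost `P`. -/
def requests (P : ℝ) (σ : List (Fin n)) : List (Request E) :=
  List.ofFn (fun S => (⟨setEdges S, I.cost S⟩ : Request E)) ++
    σ.map fun j => (⟨elemEdges j, P⟩ : Request E)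

/-- The set cover instance `I` reduces to admission control on `N` by way of the sequences
`requests`. Here `P` may be any positive number that is at least the cost of each set (in
particular `P = 1` if all costs are one), and `L` may be any class of requests that contains those
which are generated. The two offline optima agree, and each randomized online admission control
algorithm `A` is turned into a randomized online set cover algorithm `B` which never has a larger
expected cost; in particular `B` has every competitive ratio that `A` has. -/
def ReducesTo (N : Network E) : Prop :=
  ∀ P : ℝ, 0 < P → (∀ S, I.cost S ≤ P) →
  ∀ L : Set (Request E), (∀ S, (⟨setEdges S, I.cost S⟩ : Request E) ∈ L) →
    (∀ j, (⟨elemEdges j, P⟩ : Request E) ∈ L) →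
    (∀ σ, I.Coverable σ → N.opt (I.requests setEdges elemEdges P σ) = I.opt σ) ∧
    ∀ A : N.RandAlgorithm L, ∃ B : I.RandAlgorithm,
      (∀ σ, I.Coverable σ → B.expCost σ ≤ A.expCost (I.requests setEdges elemEdges P σ)) ∧
      ∀ β : ℝ, A.IsCompetitive β → B.IsCompetitive β

end SetCover

end

noncomputable section

/-! The reduction rests on complementation. The capacity of `e_j` is the number of sets containing
`j`, so every request for `e_j` in the second phase forces one rejection on that edge: of a set
containing `j`, or of an element request. Rejecting sets means buying them (`Models.feasible_iff`).
A rejected element request costs `P`, at least the cost of any set, so it pays for one further set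
containing `j`. The simulation buys all rejected sets and charges each extra set to a rejected
element request (`Charged.exists_covers`, `Charged.totalCost_le`). This gives equality of the optima
and, applied online and monotonically, the algorithm `B`.

For simple paths, the edge of `j` becomes a shortcut over two consecutive edges of a directed path,
and the request for `S` takes exactly the shortcuts of its elements. The remaining edges have room
for all sets.

The bounds for parts 3 and 4 are proved directly, without the reduction. A fractional solution is
kept by multiplicative updates: each set has a weight in `[1, m + 1]`, and on a demand for `j` the
weights of the sets containing `j` grow at relative rate `1 / cost` until `j` is covered often
enough. The potential `∑ cost * log weight` over an offline cover pays for the growth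
(`IsWeight.exists_step`), and its total range gives an `O(log (m + 1))` factor (`cost_frac_le`)
independent of cost ratios.

Independent uniform thresholds round the fractional solution, scaled by `2 log D + 2`. An arrival is
undercovered with probability at most `1 / D` (`measureReal_roundSet_lt_le`), and then one cheapest
missing set is bought. With `D = n + 1` for unit costs and `D = mn + 1` in general, the expected
cost of these repairs is at most the optimum. -/

theorem List.sum_univ_get_append {α M : Type*} [AddCommMonoid M] (f : ℕ → α → M)
    (l₁ l₂ : List α) :
    ∑ i : Fin (l₁ ++ l₂).length, f i ((l₁ ++ l₂).get i) =
      ∑ i : Fin l₁.length, f i (l₁.get i) +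
        ∑ i : Fin l₂.length, f (l₁.length + i) (l₂.get i) := by
  have h : (l₁ ++ l₂).length = l₁.length + l₂.length := List.length_append
  rw [← Equiv.sum_comp (finCongr h).symm, Fin.sum_univ_add]
  congr 1 <;> refine Finset.sum_congr rfl fun i _ => ?_ <;> simp

theorem List.sum_univ_get_ofFn {α M : Type*} [AddCommMonoid M] (f : ℕ → α → M) {k : ℕ}
    (g : Fin k → α) :
    ∑ i : Fin (List.ofFn g).length, f i ((List.ofFn g).get i) = ∑ i : Fin k, f i (g i) := by
  rw [← Equiv.sum_comp (finCongr (List.length_ofFn (f := g))).symm]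
  refine Finset.sum_congr rfl fun i _ => ?_
  simp

theorem List.sum_univ_get_map {α β M : Type*} [AddCommMonoid M] (f : ℕ → β → M)
    (g : α → β) (l : List α) :
    ∑ i : Fin (l.map g).length, f i ((l.map g).get i) =
      ∑ i : Fin l.length, f i (g (l.get i)) := by
  rw [← Equiv.sum_comp (finCongr (List.length_map (as := l) g)).symm]
  refine Finset.sum_congr rfl fun i _ => ?_
  simp

theorem List.count_eq_sum_univ_get {α : Type*} [DecidableEq α] (l : List α) (a : α) :
    l.count a = ∑ i : Fin l.length, if l.get i = a then 1 else 0 := by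
  induction l with
  | nil => simp
  | cons b l ih =>
    rw [List.count_cons, ih]
    simp only [List.length_cons, Fin.sum_univ_succ]
    simp only [beq_iff_eq, List.get_eq_getElem, Fin.val_zero, Fin.val_succ,
      List.getElem_cons_zero, List.getElem_cons_succ]
    rw [add_comm]
    congr

/-! ### Rejections read as purchases of sets -/

namespace SetCover

variable {n m : ℕ} (I : SetCover n m)

theorem cover_mono {T T' : Finset (Fin m)} (h : T ⊆ T') (j : Fin n) :
    I.cover T j ≤ I.cover T' j :=
  Finset.card_le_card (Finset.filter_subset_filter _ h)

theorem cover_le (T : Finset (Fin m)) (j : Fin n) : I.cover T j ≤ m :=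
  (Finset.card_le_univ _).trans (by simp)

theorem totalCost_nonneg (T : Finset (Fin m)) : 0 ≤ I.totalCost T :=
  Finset.sum_nonneg fun S _ => I.cost_nonneg S

theorem opt_le {σ : List (Fin n)} {T : Finset (Fin m)} (h : I.Covers T σ) :
    I.opt σ ≤ I.totalCost T :=
  csInf_le ⟨0, by rintro _ ⟨T, -, rfl⟩; exact I.totalCost_nonneg T⟩ ⟨T, h, rfl⟩

/-- The offline optimum of a sequence that can be covered is attained. -/
theorem exists_totalCost_eq_opt {σ : List (Fin n)} (h : I.Coverable σ) :
    ∃ T, I.Covers T σ ∧ I.totalCost T = I.opt σ := by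
  have hne : (I.totalCost '' {T | I.Covers T σ}).Nonempty := Set.Nonempty.image _ h
  obtain ⟨T, hT, h⟩ := hne.csInf_mem (Set.toFinite _)
  exact ⟨T, hT, h⟩

variable {I} in
theorem Covers.of_append {σ τ : List (Fin n)} {T : Finset (Fin m)} (h : I.Covers T (σ ++ τ)) :
    I.Covers T σ := fun j => by
  have := h j
  rw [List.count_append] at this
  omega

variable {I} in
theorem Coverable.of_append {σ τ : List (Fin n)} (h : I.Coverable (σ ++ τ)) : I.Coverable σ :=
  h.imp fun _ hT => hT.of_append

/-- The sets whose requests are rejected, if the positions of the rejected requests form `R`. -/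
def rejSets (m : ℕ) (R : Finset ℕ) : Finset (Fin m) := Finset.univ.filter fun S => (S : ℕ) ∈ R

/-- The number of requests for the element `j` that are rejected. -/
def rejElem (m : ℕ) (σ : List (Fin n)) (R : Finset ℕ) (j : Fin n) : ℕ :=
  ∑ i : Fin σ.length, if m + i ∈ R ∧ σ.get i = j then 1 else 0

theorem sum_rejElem (σ : List (Fin n)) (R : Finset ℕ) :
    ∑ j, rejElem m σ R j = ∑ i : Fin σ.length, if m + i ∈ R then 1 else 0 := by
  unfold rejElem
  rw [Finset.sum_comm]
  refine Finset.sum_congr rfl fun i _ => ?_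
  simp [ite_and]

theorem rejSets_mono {R R' : Finset ℕ} (h : R ⊆ R') : rejSets m R ⊆ rejSets m R' :=
  Finset.monotone_filter_right _ fun _ _ hS => h hS

theorem rejElem_mono {R R' : Finset ℕ} (h : R ⊆ R') (σ τ : List (Fin n)) (j : Fin n) :
    rejElem m σ R j ≤ rejElem m (σ ++ τ) R' j := by
  unfold rejElem
  rw [List.sum_univ_get_append (fun i a => if m + i ∈ R' ∧ a = j then 1 else 0)]
  refine le_add_of_le_of_nonneg (Finset.sum_le_sum fun i _ => ?_) (Nat.zero_le _)
  split_ifs with h1 h2 <;> first | omega | exact absurd ⟨h h1.1, h1.2⟩ h2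

section Requests

variable {E : Type} (setEdges : Fin m → Finset E) (elemEdges : Fin n → Finset E) (P : ℝ)

theorem requests_append (σ : List (Fin n)) (j : Fin n) :
    I.requests setEdges elemEdges P (σ ++ [j]) =
      I.requests setEdges elemEdges P σ ++ [⟨elemEdges j, P⟩] := by
  simp [requests]

theorem rejCost_requests (σ : List (Fin n)) (R : Finset ℕ) :
    Network.rejCost (I.requests setEdges elemEdges P σ) R =
      I.totalCost (rejSets m R) + P * ∑ j, (rejElem m σ R j : ℝ) := by
  rw [← Nat.cast_sum, sum_rejElem]
  unfold Network.rejCost requests totalCost rejSets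
  rw [List.sum_univ_get_append (fun i (r : Request E) => if i ∈ R then r.cost else 0),
    List.sum_univ_get_ofFn (fun i (r : Request E) => if i ∈ R then r.cost else 0),
    List.sum_univ_get_map
      (fun i (r : Request E) => if (List.ofFn _).length + i ∈ R then r.cost else 0)]
  simp only [List.length_ofFn, Nat.cast_sum, Nat.cast_ite, Nat.cast_one, Nat.cast_zero,
    Finset.mul_sum, mul_ite, mul_one, mul_zero, Finset.sum_filter]

open Classical in
theorem load_requests (σ : List (Fin n)) (R : Finset ℕ) (e : E) :
    Network.load (I.requests setEdges elemEdges P σ) R e =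
      (∑ S : Fin m, if (S : ℕ) ∉ R ∧ e ∈ setEdges S then 1 else 0) +
        ∑ i : Fin σ.length, if m + i ∉ R ∧ e ∈ elemEdges (σ.get i) then 1 else 0 := by
  unfold Network.load requests
  rw [Finset.card_filter,
    List.sum_univ_get_append (fun i (r : Request E) => if i ∉ R ∧ e ∈ r.edges then 1 else 0),
    List.sum_univ_get_ofFn (fun i (r : Request E) => if i ∉ R ∧ e ∈ r.edges then 1 else 0),
    List.sum_univ_get_map
      (fun i (r : Request E) => if (List.ofFn _).length + i ∉ R ∧ e ∈ r.edges then 1 else 0)]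
  simp

end Requests

/-- The edges `edge j` of a network model the set cover instance: they have the right capacities
and lie in the right requests, and all other edges have enough capacity for all sets. -/
structure Models {E : Type} (N : Network E) (edge : Fin n → E) (setEdges : Fin m → Finset E)
    (elemEdges : Fin n → Finset E) : Prop where
  cap_edge : ∀ j, N.cap (edge j) = I.network.cap j
  le_cap : ∀ e, e ∉ Set.range edge → m ≤ N.cap e
  mem_setEdges : ∀ S j, edge j ∈ setEdges S ↔ j ∈ I.sets S
  mem_elemEdges : ∀ e j, e ∈ elemEdges j ↔ e = edge j
  injective : Function.Injective edge

namespace Models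

variable {I} {E : Type} {N : Network E} {edge : Fin n → E} {setEdges : Fin m → Finset E}
    {elemEdges : Fin n → Finset E} {P : ℝ}

/-- Double counting of the requests through `edge j`: each is accepted, or a rejected set request,
or a rejected element request. -/
theorem load_add (h : I.Models N edge setEdges elemEdges) (σ : List (Fin n)) (R : Finset ℕ)
    (j : Fin n) :
    Network.load (I.requests setEdges elemEdges P σ) R (edge j) +
      (I.cover (rejSets m R) j + rejElem m σ R j) = I.cover Finset.univ j + σ.count j := by
  classical
  rw [load_requests, add_add_add_comm, List.count_eq_sum_univ_get]
  unfold cover rejSets rejElem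
  rw [Finset.filter_filter, Finset.card_filter, Finset.card_filter, ← Finset.sum_add_distrib,
    ← Finset.sum_add_distrib]
  congr 1 <;> refine Finset.sum_congr rfl fun i _ => ?_
  · have := h.mem_setEdges i j
    by_cases h1 : (i : ℕ) ∈ R <;> by_cases h2 : j ∈ I.sets i <;> simp [h1, h2, this]
  · have : edge j ∈ elemEdges (σ.get i) ↔ σ.get i = j := by
      rw [h.mem_elemEdges, h.injective.eq_iff, eq_comm]
    simp only [this]
    by_cases h1 : m + (i : ℕ) ∈ R <;> by_cases h2 : σ.get i = j <;> simp only [h1, h2] <;> simp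

/-- By `load_add`, a capacity equal to the number of sets containing `j` turns the packing
constraint into a covering constraint. The `max 1` in the capacity is harmless, since an element in
no set has count zero in a coverable sequence. Edges outside the range of `edge` carry only set
requests, at most `m` of them. -/
theorem feasible_iff (h : I.Models N edge setEdges elemEdges) {σ : List (Fin n)}
    (hσ : I.Coverable σ) (R : Finset ℕ) :
    N.Feasible (I.requests setEdges elemEdges P σ) R ↔
      ∀ j, σ.count j ≤ I.cover (rejSets m R) j + rejElem m σ R j := by
  classical
  have key : ∀ j, Network.load (I.requests setEdges elemEdges P σ) R (edge j) ≤ N.cap (edge j) ↔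
      σ.count j ≤ I.cover (rejSets m R) j + rejElem m σ R j := by
    intro j
    have h1 := h.load_add (P := P) σ R j
    have h2 : N.cap (edge j) = max 1 (I.cover Finset.univ j) := h.cap_edge j
    obtain ⟨T, hT⟩ := hσ
    have h3 := (hT j).trans (I.cover_mono (Finset.subset_univ T) j)
    rw [h2]
    omega
  refine ⟨fun hf j => (key j).1 (hf _), fun hf e => ?_⟩
  by_cases he : e ∈ Set.range edge
  · obtain ⟨j, rfl⟩ := he
    exact (key j).2 (hf j)
  · refine le_trans ?_ (h.le_cap e he)
    rw [load_requests]
    have h0 : (∑ i : Fin σ.length,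
        if m + (i : ℕ) ∉ R ∧ e ∈ elemEdges (σ.get i) then 1 else 0) = 0 := by
      refine Finset.sum_eq_zero fun i _ => if_neg ?_
      rintro ⟨-, hi⟩
      exact he ⟨_, ((h.mem_elemEdges _ _).1 hi).symm⟩
    rw [h0, add_zero, ← Finset.card_filter]
    exact (Finset.card_le_univ _).trans (by simp)

end Models

/-! ### Charging extra sets to rejected element requests -/

/-- The subfamily `T` consists of the sets in `T₀` and of sets that are charged to elements which
they contain, where the element `j` is charged at most `r j` times. -/
def Charged (T₀ : Finset (Fin m)) (r : Fin n → ℕ) (T : Finset (Fin m)) : Prop :=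
  T₀ ⊆ T ∧ ∃ X : Fin n → Finset (Fin m), T \ T₀ ⊆ Finset.univ.biUnion X ∧
    ∀ j, X j ⊆ T \ T₀ ∧ (∀ S ∈ X j, j ∈ I.sets S) ∧ (X j).card ≤ r j

variable {I}

theorem Charged.refl (T₀ : Finset (Fin m)) (r : Fin n → ℕ) : I.Charged T₀ r T₀ :=
  ⟨le_rfl, fun _ => ∅, by simp, by simp⟩

theorem Charged.totalCost_le {T₀ T : Finset (Fin m)} {r : Fin n → ℕ} (h : I.Charged T₀ r T)
    {P : ℝ} (hP : ∀ S, I.cost S ≤ P) (hP0 : 0 ≤ P) :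
    I.totalCost T ≤ I.totalCost T₀ + P * ∑ j, (r j : ℝ) := by
  obtain ⟨h0, X, hX, hr⟩ := h
  have h1 : I.totalCost T = I.totalCost T₀ + ∑ S ∈ T \ T₀, I.cost S := by
    rw [add_comm]
    exact (Finset.sum_sdiff h0).symm
  have h2 : (T \ T₀).card ≤ ∑ j, r j :=
    (Finset.card_le_card hX).trans
      (Finset.card_biUnion_le.trans (Finset.sum_le_sum fun j _ => (hr j).2.2))
  have h3 : ∑ S ∈ T \ T₀, I.cost S ≤ ((T \ T₀).card : ℝ) * P := by
    simpa using Finset.sum_le_card_nsmul (T \ T₀) I.cost P fun S _ => hP S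
  have h4 : ((T \ T₀).card : ℝ) ≤ ∑ j, (r j : ℝ) := by exact_mod_cast h2
  rw [h1]
  nlinarith

/-- Extra sets that are later rejected themselves become part of the base family, and their charges
are simply dropped. -/
theorem Charged.mono {T₀ T₁ T : Finset (Fin m)} {r r' : Fin n → ℕ} (h : I.Charged T₀ r T)
    (hT : T₀ ⊆ T₁) (hr : ∀ j, r j ≤ r' j) : I.Charged T₁ r' (T ∪ T₁) := by
  obtain ⟨-, X, hX, hX'⟩ := h
  rw [Charged, Finset.union_sdiff_right]
  refine ⟨Finset.subset_union_right, fun j => X j ∩ (T \ T₁), fun S hS => ?_, fun j =>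
    ⟨Finset.inter_subset_right, fun S hS => (hX' j).2.1 S (Finset.mem_inter.1 hS).1,
      (Finset.card_le_card Finset.inter_subset_left).trans ((hX' j).2.2.trans (hr j))⟩⟩
  have := hX (Finset.sdiff_subset_sdiff le_rfl hT hS)
  simp only [Finset.mem_biUnion, Finset.mem_univ, true_and, Finset.mem_inter] at this ⊢
  exact this.imp fun j hj => ⟨hj, hS⟩

/-- A charged subfamily extends to a charged cover, if rejections suffice for a feasible
solution. -/
theorem Charged.exists_covers {T₀ T : Finset (Fin m)} {r : Fin n → ℕ} (h : I.Charged T₀ r T)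
    {σ : List (Fin n)} (hσ : I.Coverable σ) (hc : ∀ j, σ.count j ≤ I.cover T₀ j + r j) :
    ∃ T', T ⊆ T' ∧ I.Charged T₀ r T' ∧ I.Covers T' σ := by
  classical
  -- Take a maximal charged superset. If it undercovers some `j`, coverability provides an unused
  -- set containing `j`, and charging that set to `j` contradicts maximality.
  obtain ⟨T', hTT', hmax⟩ := (Set.toFinite {T' | I.Charged T₀ r T'}).exists_le_maximal h
  refine ⟨T', hTT', hmax.prop, ?_⟩
  by_contra hcov
  simp only [Covers, not_forall, not_le] at hcov
  obtain ⟨j, hj⟩ := hcov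
  obtain ⟨h0, X, hX, hX'⟩ := hmax.prop
  obtain ⟨C, hC⟩ := hσ
  have h1 := (hC j).trans (I.cover_mono (Finset.subset_univ C) j)
  obtain ⟨S, hS, hST⟩ : ∃ S, j ∈ I.sets S ∧ S ∉ T' := by
    by_contra hno
    push Not at hno
    refine absurd (lt_of_lt_of_le hj h1) (not_lt.2 (Finset.card_le_card ?_))
    intro S hS
    simp only [Finset.mem_filter, Finset.mem_univ, true_and] at hS ⊢
    exact ⟨hno S hS, hS⟩
  have hS0 : S ∉ T₀ := fun hS0 => hST (h0 hS0)
  have hins : insert S T' \ T₀ = insert S (T' \ T₀) := Finset.insert_sdiff_of_notMem _ hS0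
  have hnew : I.Charged T₀ r (insert S T') := by
    refine ⟨h0.trans (Finset.subset_insert _ _), Function.update X j (insert S (X j)), ?_, ?_⟩
    · rw [hins]
      intro S' hS'
      rw [Finset.mem_biUnion]
      rcases Finset.mem_insert.1 hS' with rfl | hS'
      · exact ⟨j, Finset.mem_univ _, by simp⟩
      · obtain ⟨k, -, hk⟩ := Finset.mem_biUnion.1 (hX hS')
        refine ⟨k, Finset.mem_univ _, ?_⟩
        rcases eq_or_ne k j with rfl | hne
        · simp [hk]
        · rwa [Function.update_of_ne hne]
    · intro k
      rw [hins]
      rcases eq_or_ne k j with rfl | hne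
      · rw [Function.update_self]
        refine ⟨Finset.insert_subset_insert _ (hX' k).1, ?_, (Finset.card_insert_le _ _).trans ?_⟩
        · intro S' hS'
          rcases Finset.mem_insert.1 hS' with rfl | hS'
          exacts [hS, (hX' k).2.1 S' hS']
        -- There is room for one more charge: all sets charged to `k` contain `k` and lie outside
        -- `T₀`, so their number is at most `cover T' k - cover T₀ k`, which is less than `count k -
        -- cover T₀ k ≤ r k`.
        · have h2 : X k ⊆ (T' \ T₀).filter fun S' => k ∈ I.sets S' := fun S' hS' =>
            Finset.mem_filter.2 ⟨(hX' k).1 hS', (hX' k).2.1 S' hS'⟩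
          have h3 : I.cover T' k = I.cover T₀ k +
              ((T' \ T₀).filter fun S' => k ∈ I.sets S').card := by
            unfold cover
            rw [← Finset.card_union_of_disjoint, ← Finset.filter_union,
              Finset.union_sdiff_of_subset h0]
            exact Finset.disjoint_filter_filter Finset.disjoint_sdiff
          have h4 := Finset.card_le_card h2
          have h5 := hc k
          omega
      · rw [Function.update_of_ne hne]
        exact ⟨(hX' k).1.trans (Finset.subset_insert _ _), (hX' k).2⟩
  exact hST (hmax.le_of_ge hnew (Finset.subset_insert _ _) (Finset.mem_insert_self _ _))

/-! ### The online simulation and the reduction -/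

/-- The response of the set cover algorithm that has bought `T`, when the rejected positions
after the requests for `σ` form `R`. -/
def response (I : SetCover n m) (σ : List (Fin n)) (T : Finset (Fin m)) (R : Finset ℕ) :
    Finset (Fin m) :=
  open Classical in
  if h : ∃ T', T ⊆ T' ∧ I.Charged (rejSets m R) (rejElem m σ R) T' ∧ I.Covers T' σ then h.choose
  else T

theorem subset_response (σ : List (Fin n)) (T : Finset (Fin m)) (R : Finset ℕ) :
    T ⊆ I.response σ T R := by
  unfold response
  split_ifs with h
  · exact h.choose_spec.1
  · exact le_rfl

/-- The sets bought, where `rej σ` is the set of rejected positions after the requests for `σ`.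
The elements of the sequence are listed in reverse. -/
def respondRev (I : SetCover n m) (rej : List (Fin n) → Finset ℕ) :
    List (Fin n) → Finset (Fin m)
  | [] => I.response [] ∅ (rej [])
  | j :: τ => I.response (j :: τ).reverse (respondRev I rej τ) (rej (j :: τ).reverse)

theorem charged_respondRev {rej : List (Fin n) → Finset ℕ}
    (hmono : ∀ σ j, rej σ ⊆ rej (σ ++ [j]))
    (hrej : ∀ σ, I.Coverable σ → ∀ j, σ.count j ≤
      I.cover (rejSets m (rej σ)) j + rejElem m σ (rej σ) j) (τ : List (Fin n))
    (hτ : I.Coverable τ.reverse) :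
    I.Charged (rejSets m (rej τ.reverse)) (rejElem m τ.reverse (rej τ.reverse))
      (I.respondRev rej τ) ∧ I.Covers (I.respondRev rej τ) τ.reverse := by
  -- The previous purchase `T` need not contain the newly rejected sets, so it is only required to
  -- lie in some charged `T'`.
  have step : ∀ (σ : List (Fin n)) (T T' : Finset (Fin m)), T ⊆ T' → I.Coverable σ →
      I.Charged (rejSets m (rej σ)) (rejElem m σ (rej σ)) T' →
      I.Charged (rejSets m (rej σ)) (rejElem m σ (rej σ)) (I.response σ T (rej σ)) ∧
        I.Covers (I.response σ T (rej σ)) σ := by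
    intro σ T T' hTT' hσ hch
    obtain ⟨T'', h1, h2⟩ := hch.exists_covers hσ (hrej _ hσ)
    have hex : ∃ T', T ⊆ T' ∧ I.Charged (rejSets m (rej σ)) (rejElem m σ (rej σ)) T' ∧
        I.Covers T' σ := ⟨T'', hTT'.trans h1, h2⟩
    rw [response, dif_pos hex]
    exact hex.choose_spec.2
  induction τ with
  | nil => exact step [] ∅ _ (Finset.empty_subset _) hτ (.refl _ _)
  | cons j τ ih =>
    refine step _ _ _ Finset.subset_union_left hτ ((ih ?_).1.mono (rejSets_mono ?_)
      fun k => ?_)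
    · rw [List.reverse_cons] at hτ
      exact hτ.of_append
    · rw [List.reverse_cons]
      exact hmono _ _
    · rw [List.reverse_cons]
      exact rejElem_mono (hmono _ _) _ _ _

/-- The deterministic set cover algorithm that responds to the rejections `rej`. -/
def respondAlgorithm (I : SetCover n m) (rej : List (Fin n) → Finset ℕ)
    (hmono : ∀ σ j, rej σ ⊆ rej (σ ++ [j]))
    (hrej : ∀ σ, I.Coverable σ → ∀ j, σ.count j ≤
      I.cover (rejSets m (rej σ)) j + rejElem m σ (rej σ) j) : I.Algorithm where
  chosen σ := I.respondRev rej σ.reverse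
  mono σ j := by
    rw [List.reverse_append]
    exact subset_response _ _ _
  covers σ hσ := by
    have := (charged_respondRev hmono hrej σ.reverse (by rwa [List.reverse_reverse])).2
    rwa [List.reverse_reverse] at this

/-- The purchases depend on `ω` only through finitely many values of `rej`, each in the countable
type `Finset ℕ`, so the event is a countable union. -/
theorem measurableSet_respondRev {Ω : Type} [MeasurableSpace Ω]
    {rej : Ω → List (Fin n) → Finset ℕ} (h : ∀ σ R, MeasurableSet {ω | rej ω σ = R})
    (τ : List (Fin n)) (T : Finset (Fin m)) :
    MeasurableSet {ω | I.respondRev (rej ω) τ = T} := by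
  induction τ generalizing T with
  | nil =>
    have : {ω | I.respondRev (rej ω) [] = T} =
        ⋃ R, {ω | rej ω [] = R ∧ I.response [] ∅ R = T} := by
      ext ω
      simp [respondRev]
    rw [this]
    exact .iUnion fun R => (h [] R).inter (.const _)
  | cons j τ ih =>
    have : {ω | I.respondRev (rej ω) (j :: τ) = T} = ⋃ R, ⋃ T₀,
        {ω | rej ω (j :: τ).reverse = R} ∩ ({ω | I.respondRev (rej ω) τ = T₀} ∩
          {ω | I.response (j :: τ).reverse T₀ R = T}) := by
      ext ω
      simp [respondRev]
    rw [this]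
    exact .iUnion fun R => .iUnion fun T₀ => (h _ R).inter ((ih T₀).inter (.const _))

theorem Models.reducesTo {E : Type} {N : Network E} {edge : Fin n → E}
    {setEdges : Fin m → Finset E} {elemEdges : Fin n → Finset E}
    (h : I.Models N edge setEdges elemEdges) : I.ReducesTo setEdges elemEdges N := by
  intro P hP hcP L hLS hLj
  have hL : ∀ σ, ∀ r ∈ I.requests setEdges elemEdges P σ, r ∈ L := by
    intro σ r hr
    rcases List.mem_append.1 hr with hr | hr
    · obtain ⟨S, rfl⟩ := (List.mem_ofFn' _ _).1 hr
      exact hLS S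
    · obtain ⟨j, -, rfl⟩ := List.mem_map.1 hr
      exact hLj j
  have hnn : ∀ σ R, 0 ≤ Network.rejCost (I.requests setEdges elemEdges P σ) R := by
    intro σ R
    rw [rejCost_requests]
    have := I.totalCost_nonneg (rejSets m R)
    positivity
  have hopt : ∀ σ, I.Coverable σ →
      N.opt (I.requests setEdges elemEdges P σ) = I.opt σ := by
    intro σ hσ
    -- A cover is turned into a feasible solution of equal cost by rejecting exactly the requests of
    -- its sets and no element request.
    have hle : ∀ T, I.Covers T σ → ∃ R, N.Feasible (I.requests setEdges elemEdges P σ) R ∧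
        Network.rejCost (I.requests setEdges elemEdges P σ) R = I.totalCost T := by
      intro T hT
      have h1 : rejSets m (T.map Fin.valEmbedding) = T := by
        ext S
        simp [rejSets, Fin.val_inj]
      have h2 : ∀ j, rejElem m σ (T.map Fin.valEmbedding) j = 0 := by
        intro j
        refine Finset.sum_eq_zero fun i _ => if_neg ?_
        rintro ⟨hi, -⟩
        obtain ⟨S, -, hS⟩ := Finset.mem_map.1 hi
        have := S.2
        simp only [Fin.valEmbedding_apply] at hS
        omega
      refine ⟨T.map Fin.valEmbedding, (h.feasible_iff hσ _).2 fun j => ?_, ?_⟩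
      · rw [h1]
        exact (hT j).trans (Nat.le_add_right _ _)
      · rw [rejCost_requests, h1]
        simp [h2]
    apply le_antisymm
    · obtain ⟨T, hT, hTo⟩ := I.exists_totalCost_eq_opt hσ
      obtain ⟨R, hR, hRT⟩ := hle T hT
      rw [← hTo, ← hRT]
      exact csInf_le ⟨0, by rintro _ ⟨R, -, rfl⟩; exact hnn σ R⟩ ⟨R, hR, rfl⟩
    · obtain ⟨T, hT⟩ := hσ
      obtain ⟨R, hR, -⟩ := hle T hT
      refine le_csInf ⟨_, R, hR, rfl⟩ ?_
      rintro _ ⟨R, hR, rfl⟩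
      -- Conversely, the sets rejected in a feasible solution extend to a charged cover, which costs
      -- no more than the rejections.
      obtain ⟨T', -, hch, hcov⟩ := (Charged.refl (I := I) (rejSets m R)
        (rejElem m σ R)).exists_covers ⟨T, hT⟩ ((h.feasible_iff ⟨T, hT⟩ R).1 hR)
      rw [rejCost_requests]
      exact (I.opt_le hcov).trans (hch.totalCost_le hcP hP.le)
  refine ⟨hopt, fun A => ?_⟩
  let rej (ω : A.Ω) (σ : List (Fin n)) : Finset ℕ :=
    (A.alg ω).rejected (I.requests setEdges elemEdges P σ)
  have hmono : ∀ ω σ j, rej ω σ ⊆ rej ω (σ ++ [j]) := by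
    intro ω σ j
    have h1 := hL (σ ++ [j])
    simp only [rej]
    rw [requests_append] at h1 ⊢
    exact (A.alg ω).mono _ _ h1
  have hrej : ∀ ω σ, I.Coverable σ → ∀ j, σ.count j ≤
      I.cover (rejSets m (rej ω σ)) j + rejElem m σ (rej ω σ) j := fun ω σ hσ =>
    (h.feasible_iff hσ _).1 ((A.alg ω).feasible _ (hL σ))
  have hmeas : ∀ σ R, MeasurableSet {ω | rej ω σ = R} := fun σ R =>
    A.measurable_rejected _ (hL σ) R
  let B : I.RandAlgorithm :=
    { Ω := A.Ω
      μ := A.μ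
      alg := fun ω => I.respondAlgorithm (rej ω) (hmono ω) (hrej ω)
      measurable_chosen := fun σ T => measurableSet_respondRev hmeas σ.reverse T }
  have hB : ∀ σ, I.Coverable σ →
      B.expCost σ ≤ A.expCost (I.requests setEdges elemEdges P σ) := by
    intro σ hσ
    refine integral_mono_of_nonneg (.of_forall fun ω => I.totalCost_nonneg _) ?_
      (.of_forall fun ω => ?_)
    -- With the discrete σ-algebra on `Finset ℕ` the rejection cost is measurable; it is bounded by
    -- the sum of the absolute costs.
    · let _ : MeasurableSpace (Finset ℕ) := ⊤
      have h1 : Measurable fun ω => rej ω σ := measurable_to_countable' fun R => hmeas σ R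
      have h2 : Measurable fun ω =>
          Network.rejCost (I.requests setEdges elemEdges P σ) (rej ω σ) :=
        (measurable_from_top (f := Network.rejCost (I.requests setEdges elemEdges P σ))).comp h1
      refine Integrable.of_bound h2.aestronglyMeasurable
        (∑ i, |((I.requests setEdges elemEdges P σ).get i).cost|) (.of_forall fun ω => ?_)
      refine (Finset.abs_sum_le_sum_abs _ _).trans (Finset.sum_le_sum fun i _ => ?_)
      split_ifs <;> simp
    · have h1 := (charged_respondRev (hmono ω) (hrej ω) σ.reverse
        (by rwa [List.reverse_reverse])).1
      rw [List.reverse_reverse] at h1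
      refine (h1.totalCost_le hcP hP.le).trans_eq ?_
      rw [← rejCost_requests (setEdges := setEdges) (elemEdges := elemEdges)]
  refine ⟨B, hB, fun β hβ σ hσ => (hB σ hσ).trans ?_⟩
  rw [← hopt σ hσ]
  exact hβ _ (hL σ)

/-- Each element gives an edge of its own. -/
theorem models_network : I.Models I.network id I.sets fun j => {j} where
  cap_edge _ := rfl
  le_cap e he := absurd ⟨e, rfl⟩ he
  mem_setEdges _ _ := Iff.rfl
  mem_elemEdges _ _ := Finset.mem_singleton
  injective := Function.injective_id

theorem network_cap_le (hm : 0 < m) (j : Fin n) : I.network.cap j ≤ m :=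
  max_le hm (I.cover_le _ _)

end SetCover

/-! ### Requests as simple paths in a digraph with shortcuts -/

/-- Two members of a strictly increasing list that are adjacent have no member in between. -/
theorem List.SortedLT.le_or_le_of_isInfix {α : Type*} [LinearOrder α] {l : List α}
    (hl : l.SortedLT) {a b c : α} (hab : [a, b] <:+: l) (hc : c ∈ l) : c ≤ a ∨ b ≤ c := by
  obtain ⟨s, t, rfl⟩ := hab
  have hp := hl.pairwise
  simp only [List.pairwise_append, List.mem_append, List.mem_cons] at hp hc
  grind

theorem List.isChain_of_forall_isInfix {α : Type*} {R : α → α → Prop} {l : List α}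
    (h : ∀ a b, [a, b] <:+: l → R a b) : l.IsChain R := by
  induction l with
  | nil => exact .nil
  | cons a l ih =>
    cases l with
    | nil => exact .singleton a
    | cons b l =>
      exact .cons_cons (h a b ⟨[], l, rfl⟩) (ih fun x y hxy => h x y (hxy.trans ⟨[a], [], by simp⟩))

theorem List.pair_isInfix_pair {α : Type*} {a b c d : α} :
    [a, b] <:+: [c, d] ↔ a = c ∧ b = d := by
  constructor
  · intro h
    simpa using h.eq_of_length rfl
  · rintro ⟨rfl, rfl⟩
    exact List.infix_rfl

/-- A directed path with `2 * n` edges and with a shortcut for every other pair of edges. -/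
def shortcutDigraph (n : ℕ) : Digraph (Fin (2 * n + 1)) where
  Adj a b := (b : ℕ) = a + 1 ∨ (a : ℕ) % 2 = 0 ∧ (b : ℕ) = a + 2

namespace shortcutDigraph

variable {n : ℕ}

/-- The vertex with number `2 * j + i`. -/
def vertex (j : Fin n) (i : ℕ) (hi : i ≤ 2) : Fin (2 * n + 1) := ⟨2 * j + i, by omega⟩

/-- The shortcuts are the edges that model the elements. -/
def edge (j : Fin n) : (shortcutDigraph n).Edge :=
  ⟨(vertex j 0 (by omega), vertex j 2 le_rfl), Or.inr ⟨by simp [vertex], by simp [vertex]⟩⟩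

theorem edge_injective : Function.Injective (edge (n := n)) := by
  intro j k h
  have := congrArg (fun e => (e.1.1 : ℕ)) h
  simp only [edge, vertex] at this
  omega

instance : Finite (shortcutDigraph n).Edge := by
  unfold Digraph.Edge
  infer_instance

theorem card_edge_le (n : ℕ) : Nat.card (shortcutDigraph n).Edge ≤ 3 * n := by
  -- Unit steps are determined by their tail, shortcuts by half of their even tail.
  let f (e : (shortcutDigraph n).Edge) : Fin (2 * n) ⊕ Fin n :=
    if h : (e.1.2 : ℕ) = e.1.1 + 1 then Sum.inl ⟨e.1.1, by have := e.1.2.2; omega⟩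
    else Sum.inr ⟨e.1.1 / 2, by
      have h1 := e.1.2.2
      have h2 := e.2
      simp only [shortcutDigraph] at h2
      omega⟩
  have hf : Function.Injective f := by
    intro e e' h
    have he := e.2
    have he' := e'.2
    simp only [f, shortcutDigraph] at h he he'
    refine Subtype.ext (Prod.ext (Fin.ext ?_) (Fin.ext ?_)) <;> split_ifs at h <;>
      simp only [Sum.inl.injEq, Sum.inr.injEq, Fin.mk.injEq] at h <;> omega
  calc Nat.card (shortcutDigraph n).Edge ≤ Nat.card (Fin (2 * n) ⊕ Fin n) :=
        Nat.card_le_card_of_injective f hf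
    _ = 3 * n := by simp; omega

/-- The vertices of the path that uses the shortcuts for the elements of `X`. -/
def vertices (X : Finset (Fin n)) : List (Fin (2 * n + 1)) :=
  (List.finRange (2 * n + 1)).filter fun a => ∀ j ∈ X, (a : ℕ) ≠ 2 * j + 1

open Classical in
/-- The path that uses the shortcuts for the elements of `X`. -/
def path (X : Finset (Fin n)) : Finset (shortcutDigraph n).Edge :=
  have := Fintype.ofFinite (shortcutDigraph n).Edge
  Finset.univ.filter fun e => [e.1.1, e.1.2] <:+: vertices X

theorem mem_path {X : Finset (Fin n)} {e : (shortcutDigraph n).Edge} :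
    e ∈ path X ↔ [e.1.1, e.1.2] <:+: vertices X := by
  simp [path]

theorem sortedLT_vertices (X : Finset (Fin n)) : (vertices X).SortedLT :=
  ((List.sortedLT_finRange _).pairwise.filter _).sortedLT

theorem mem_vertices {X : Finset (Fin n)} {a : Fin (2 * n + 1)} :
    a ∈ vertices X ↔ ∀ j ∈ X, (a : ℕ) ≠ 2 * j + 1 := by
  simp [vertices]

theorem isSimplePath_path (X : Finset (Fin n)) : (shortcutDigraph n).IsSimplePath (path X) := by
  -- Even vertices are never omitted, so a jump longer than the digraph allows would skip a listed
  -- vertex: `a + 2` for even `a`, `a + 1` for odd `a`.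
  have hmem : ∀ a : Fin (2 * n + 1), (a : ℕ) % 2 = 0 → a ∈ vertices X := fun a ha =>
    mem_vertices.2 fun j _ => by omega
  refine ⟨vertices X, List.ne_nil_of_mem (hmem 0 rfl), (sortedLT_vertices X).nodup,
    List.isChain_of_forall_isInfix fun a b hab => ?_, fun e => mem_path⟩
  have hlt : a < b := by
    have := (sortedLT_vertices X).pairwise.sublist hab.sublist
    simpa using this
  have hb := b.2
  have hlt' : (a : ℕ) < b := hlt
  by_contra hadj
  simp only [shortcutDigraph, not_or, not_and] at hadj
  rcases Nat.mod_two_eq_zero_or_one a with h | h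
  · rcases (sortedLT_vertices X).le_or_le_of_isInfix hab
      (hmem ⟨a + 2, by omega⟩ (by simpa using h)) with h1 | h1 <;>
      simp only [Fin.le_def] at h1 <;> omega
  · rcases (sortedLT_vertices X).le_or_le_of_isInfix hab
      (hmem ⟨a + 1, by omega⟩ (by simp; omega)) with h1 | h1 <;>
      simp only [Fin.le_def] at h1 <;> omega

theorem vertex_isInfix_finRange (j : Fin n) :
    [vertex j 0 (by omega), vertex j 1 (by omega), vertex j 2 le_rfl] <:+:
      List.finRange (2 * n + 1) := by
  refine ⟨(List.finRange (2 * n + 1)).take (2 * j),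
    (List.finRange (2 * n + 1)).drop (2 * j + 3), ?_⟩
  have := j.2
  refine List.ext_getElem (by simp; omega) fun i h1 h2 => ?_
  simp only [List.length_finRange] at h2
  simp only [List.append_assoc, List.getElem_append, List.length_take, List.length_finRange,
    List.getElem_take, List.getElem_finRange, List.length_cons, List.length_nil,
    List.getElem_drop, vertex, List.getElem_cons]
  split_ifs <;> ext <;> simp <;> omega

theorem edge_mem_path {X : Finset (Fin n)} {j : Fin n} : edge j ∈ path X ↔ j ∈ X := by
  rw [mem_path]
  constructor
  · intro h
    by_contra hj
    have h1 : vertex j 1 (by omega) ∈ vertices X := mem_vertices.2 fun k hk => by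
      have : k ≠ j := fun h => hj (h ▸ hk)
      have : (k : ℕ) ≠ j := Fin.val_ne_of_ne this
      simp only [vertex]
      omega
    rcases (sortedLT_vertices X).le_or_le_of_isInfix h h1 with h1 | h1 <;>
      simp only [edge, vertex, Fin.le_def] at h1 <;> omega
  · intro hj
    -- Filtering the block `2j, 2j + 1, 2j + 2` removes just its middle vertex, which leaves the
    -- ends of the shortcut adjacent.
    have h := (vertex_isInfix_finRange j).filter fun a : Fin (2 * n + 1) =>
      decide (∀ j ∈ X, (a : ℕ) ≠ 2 * j + 1)
    have h0 : ∀ k ∈ X, ((vertex j 0 (by omega) : Fin (2 * n + 1)) : ℕ) ≠ 2 * k + 1 := fun k _ => by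
      simp only [vertex]; omega
    have h1 : ¬ ∀ k ∈ X, ((vertex j 1 (by omega) : Fin (2 * n + 1)) : ℕ) ≠ 2 * k + 1 :=
      fun h => h j hj rfl
    have h2 : ∀ k ∈ X, ((vertex j 2 le_rfl : Fin (2 * n + 1)) : ℕ) ≠ 2 * k + 1 := fun k _ => by
      simp only [vertex]; omega
    rwa [List.filter_cons_of_pos (by simpa using h0), List.filter_cons_of_neg (by simpa using h1),
      List.filter_cons_of_pos (by simpa using h2), List.filter_nil] at h

theorem isSimplePath_singleton {V : Type} {G : Digraph V} (e : G.Edge) (he : e.1.1 ≠ e.1.2) :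
    G.IsSimplePath {e} := by
  refine ⟨[e.1.1, e.1.2], by simp, by simpa using he, by simpa using e.2, fun e' => ?_⟩
  rw [List.pair_isInfix_pair, Finset.mem_singleton, Subtype.ext_iff, Prod.ext_iff]

open Classical in
/-- The shortcuts get the capacities of the elements, and the other edges large ones. -/
def network {m : ℕ} (I : SetCover n m) : Network (shortcutDigraph n).Edge where
  cap e := if h : ∃ j, edge j = e then I.network.cap h.choose else max 1 m
  cap_pos e := by
    split_ifs
    · exact I.network.cap_pos _
    · exact lt_of_lt_of_le Nat.zero_lt_one (le_max_left _ _)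

variable {m : ℕ} (I : SetCover n m)

theorem network_cap_edge (j : Fin n) : (network I).cap (edge j) = I.network.cap j := by
  have h : ∃ k, edge k = edge j := ⟨j, rfl⟩
  simp only [network, dif_pos h]
  rw [edge_injective h.choose_spec]

theorem network_cap_le (hm : 0 < m) (e : (shortcutDigraph n).Edge) : (network I).cap e ≤ m := by
  simp only [network]
  split_ifs
  · exact SetCover.network_cap_le hm _
  · exact max_le hm le_rfl

theorem models : I.Models (network I) edge (fun S => path (I.sets S)) fun j => {edge j} where
  cap_edge := network_cap_edge I
  le_cap e he := by
    have h : ¬ ∃ j, edge j = e := he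
    simp only [network, dif_neg h]
    exact le_max_right _ _
  mem_setEdges _ _ := edge_mem_path
  mem_elemEdges _ _ := Finset.mem_singleton
  injective := edge_injective

end shortcutDigraph

/-! ### The fractional online algorithm and its entropy potential -/

namespace SetCover

variable {n m : ℕ} (I : SetCover n m)

/-- Weights of the sets, on a scale on which `1` stands for a set that is not chosen and `m + 1`
for a set that is chosen. -/
structure IsWeight (w : Fin m → ℝ) : Prop where
  one_le : ∀ S, 1 ≤ w S
  le : ∀ S, w S ≤ m + 1
  eq_of_cost_eq_zero : ∀ S, I.cost S = 0 → w S = m + 1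

/-- The weights `w'` grow from `w` so as to cover the element `j` fractionally `t` times, and the
cost of this is controlled by the entropy relative to each subfamily that covers `j` as often. -/
structure IsWeightStep (w : Fin m → ℝ) (j : Fin n) (t : ℕ) (w' : Fin m → ℝ) : Prop where
  isWeight : I.IsWeight w'
  le : ∀ S, w S ≤ w' S
  covers : (m : ℝ) * t ≤ ∑ S with j ∈ I.sets S, (w' S - 1)
  cost_le : ∀ T, t ≤ I.cover T j → ∑ S, I.cost S * (w' S - w S) ≤
    2 * m * ∑ S ∈ T, I.cost S * (Real.log (w' S) - Real.log (w S))

variable {I}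

/-- From `log x ≤ x - 1` at `x = a / b`; it bounds the growth of a weight by the growth of its
logarithm. -/
theorem sub_le_mul_log_sub {a b : ℝ} (ha : 0 < a) (hb : 0 < b) :
    b - a ≤ b * (Real.log b - Real.log a) := by
  have h := Real.log_le_sub_one_of_pos (div_pos ha hb)
  rw [Real.log_div ha.ne' hb.ne'] at h
  have h2 : b * (Real.log a - Real.log b) ≤ b * (a / b - 1) := mul_le_mul_of_nonneg_left h hb.le
  have h3 : b * (a / b - 1) = a - b := by field_simp
  linarith

/-- The weights after all weights of sets that contain `j` have been raised by the amount `y`. -/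
def raise (I : SetCover n m) (w : Fin m → ℝ) (j : Fin n) (y : ℝ) (S : Fin m) : ℝ :=
  if j ∈ I.sets S then min (m + 1) (w S * Real.exp (y / I.cost S)) else w S

variable {w : Fin m → ℝ}

theorem IsWeight.raise (hw : I.IsWeight w) (j : Fin n) {y : ℝ} (hy : 0 ≤ y) :
    I.IsWeight (I.raise w j y) ∧ ∀ S, w S ≤ I.raise w j y S := by
  have hle : ∀ S, w S ≤ I.raise w j y S := by
    intro S
    unfold SetCover.raise
    split_ifs
    · refine le_min (hw.le S) (le_mul_of_one_le_right (zero_le_one.trans (hw.one_le S)) ?_)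
      exact Real.one_le_exp (div_nonneg hy (I.cost_nonneg S))
    · exact le_rfl
  have hle' : ∀ S, I.raise w j y S ≤ m + 1 := by
    intro S
    unfold SetCover.raise
    split_ifs
    · exact min_le_left _ _
    · exact hw.le S
  exact ⟨⟨fun S => (hw.one_le S).trans (hle S), hle', fun S hS =>
    le_antisymm (hle' S) ((hw.eq_of_cost_eq_zero S hS).symm.le.trans (hle S))⟩, hle⟩

/-- Intermediate value theorem in `y`. Sets of cost zero, where `y / 0 = 0`, cause no trouble
because they are saturated from the start. -/
theorem IsWeight.exists_raise_eq (hw : I.IsWeight w) {j : Fin n} {t : ℕ}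
    (ht : t ≤ I.cover Finset.univ j) (hlt : ∑ S with j ∈ I.sets S, (w S - 1) < (m : ℝ) * t) :
    ∃ y, 0 < y ∧ ∑ S with j ∈ I.sets S, (I.raise w j y S - 1) = (m : ℝ) * t := by
  let G (y : ℝ) : ℝ := ∑ S with j ∈ I.sets S, (I.raise w j y S - 1)
  have hG : Continuous G := by
    refine continuous_finsetSum _ fun S _ => Continuous.sub ?_ continuous_const
    unfold SetCover.raise
    split_ifs <;> fun_prop
  have hG0 : G 0 = ∑ S with j ∈ I.sets S, (w S - 1) := by
    refine Finset.sum_congr rfl fun S hS => ?_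
    have : j ∈ I.sets S := (Finset.mem_filter.1 hS).2
    simp [SetCover.raise, this, hw.le S]
  have hm : (1 : ℝ) ≤ m + 1 := by simp
  have hlog : 0 ≤ Real.log (m + 1) := Real.log_nonneg hm
  -- At this level every set containing `j` is saturated, since `exp (Y / cost) ≥ m + 1` when the
  -- cost is positive.
  let Y : ℝ := ∑ S, I.cost S * Real.log (m + 1)
  have hY : 0 ≤ Y := Finset.sum_nonneg fun S _ => mul_nonneg (I.cost_nonneg S) hlog
  have hGY : G Y = (m : ℝ) * I.cover Finset.univ j := by
    have : ∀ S ∈ Finset.univ.filter (fun S => j ∈ I.sets S), I.raise w j Y S - 1 = m := by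
      intro S hS
      have hS : j ∈ I.sets S := (Finset.mem_filter.1 hS).2
      rw [SetCover.raise, if_pos hS, min_eq_left, add_sub_cancel_right]
      rcases (I.cost_nonneg S).eq_or_lt with h0 | h0
      · rw [← h0, hw.eq_of_cost_eq_zero S h0.symm]
        simp
      · have h1 : I.cost S * Real.log (m + 1) ≤ Y :=
          Finset.single_le_sum (f := fun S => I.cost S * Real.log (m + 1))
            (fun S _ => mul_nonneg (I.cost_nonneg S) hlog) (Finset.mem_univ S)
        have h2 : Real.log (m + 1) ≤ Y / I.cost S := by
          rw [le_div_iff₀ h0]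
          linarith
        have h3 := Real.exp_le_exp.2 h2
        rw [Real.exp_log (by positivity)] at h3
        exact h3.trans (le_mul_of_one_le_left (Real.exp_pos _).le (hw.one_le S))
    simp only [G]
    rw [Finset.sum_congr rfl this, Finset.sum_const, nsmul_eq_mul, mul_comm]
    rfl
  have hmem : (m : ℝ) * t ∈ Set.Icc (G 0) (G Y) := by
    refine ⟨hG0.trans_le hlt.le, ?_⟩
    rw [hGY]
    exact mul_le_mul_of_nonneg_left (by exact_mod_cast ht) (Nat.cast_nonneg m)
  obtain ⟨y, hy, hGy⟩ := intermediate_value_Icc hY hG.continuousOn hmem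
  refine ⟨y, hy.1.lt_of_ne ?_, hGy⟩
  rintro rfl
  exact absurd (hG0.symm.trans hGy) hlt.ne

/-- Let `u S` be the gain `cost * log (w' / w)`. It equals `y` on unsaturated sets containing `j`
and is at most `y` on saturated ones; let `K` count the latter. Any `T` covering `j` at least `t`
times gains at least `y (t - K)` plus the gains of all saturated sets, while the cost is at most
`2m` times this amount. Since `T` is arbitrary, the step can be chosen without knowing the optimum.
-/
theorem IsWeight.exists_step (hw : I.IsWeight w) {j : Fin n} {t : ℕ}
    (ht : t ≤ I.cover Finset.univ j) : ∃ w', I.IsWeightStep w j t w' := by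
  classical
  by_cases hlt : (m : ℝ) * t ≤ ∑ S with j ∈ I.sets S, (w S - 1)
  · exact ⟨w, hw, fun _ => le_rfl, hlt, fun T _ => by simp⟩
  push Not at hlt
  obtain ⟨y, hy, hsum⟩ := hw.exists_raise_eq ht hlt
  obtain ⟨hw', hle⟩ := hw.raise j hy.le
  set w' := I.raise w j y with hw'def
  refine ⟨w', hw', hle, hsum.ge, fun T hT => ?_⟩
  set A := Finset.univ.filter fun S => j ∈ I.sets S with hA
  let u (S : Fin m) : ℝ := I.cost S * (Real.log (w' S) - Real.log (w S))
  let k (S : Fin m) : ℝ := if w' S = m + 1 then 1 else 0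
  let a (S : Fin m) : ℝ := if S ∈ T then 1 else 0
  have hwpos : ∀ S, 0 < w S := fun S => zero_lt_one.trans_le (hw.one_le S)
  have hw'pos : ∀ S, 0 < w' S := fun S => zero_lt_one.trans_le (hw'.one_le S)
  have hu0 : ∀ S, 0 ≤ u S := fun S =>
    mul_nonneg (I.cost_nonneg S) (sub_nonneg.2 (Real.log_le_log (hwpos S) (hle S)))
  have huout : ∀ S, S ∉ A → w' S = w S := by
    intro S hS
    have : j ∉ I.sets S := fun h => hS (Finset.mem_filter.2 ⟨Finset.mem_univ _, h⟩)
    rw [hw'def, SetCover.raise, if_neg this]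
  have hraise : ∀ S ∈ A, w' S = min ((m : ℝ) + 1) (w S * Real.exp (y / I.cost S)) := by
    intro S hS
    rw [hw'def, SetCover.raise, if_pos (Finset.mem_filter.1 hS).2]
  have hlogexp : ∀ S, I.cost S ≠ 0 →
      I.cost S * (Real.log (w S * Real.exp (y / I.cost S)) - Real.log (w S)) = y := by
    intro S hS
    rw [Real.log_mul (hwpos S).ne' (Real.exp_pos _).ne', Real.log_exp]
    field_simp
    ring
  have huy : ∀ S ∈ A, u S ≤ y := by
    intro S hS
    by_cases h0 : I.cost S = 0
    · simp only [u, h0, zero_mul]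
      exact hy.le
    · rw [← hlogexp S h0]
      refine mul_le_mul_of_nonneg_left (sub_le_sub_right (Real.log_le_log (hw'pos S) ?_) _)
        (I.cost_nonneg S)
      rw [hraise S hS]
      exact min_le_right _ _
  have hun : ∀ S ∈ A, w' S ≠ m + 1 → u S = y ∧ 1 < w' S := by
    intro S hS hne
    have h0 : I.cost S ≠ 0 := fun h => hne (hw'.eq_of_cost_eq_zero S h)
    have heq : w' S = w S * Real.exp (y / I.cost S) := by
      rw [hraise S hS] at hne ⊢
      rcases min_choice ((m : ℝ) + 1) (w S * Real.exp (y / I.cost S)) with h | h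
      · exact absurd h hne
      · exact h
    refine ⟨by simp only [u]; rw [heq, hlogexp S h0], heq ▸ ?_⟩
    have h1 : 1 < Real.exp (y / I.cost S) :=
      Real.one_lt_exp_iff.2 (div_pos hy ((I.cost_nonneg S).lt_of_ne (Ne.symm h0)))
    nlinarith [hw.one_le S]
  -- the number of sets that have reached the largest weight
  have hκ : ∑ S ∈ A, k S = ((A.filter fun S => w' S = m + 1).card : ℝ) := by
    simp [k]
  set K := (A.filter fun S => w' S = m + 1).card
  have hU : ∑ S ∈ A, (1 - k S) * (w' S - 1) = m * t - m * K := by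
    rw [← hsum, ← hκ, Finset.mul_sum, ← Finset.sum_sub_distrib]
    refine Finset.sum_congr rfl fun S _ => ?_
    by_cases h : w' S = m + 1 <;> simp [k, h]
  -- The number of unsaturated sets is at most `m (t - K)`: if there is one, its excess weight is
  -- positive, so `K < t` by integrality and `m (t - K) ≥ m`.
  have hcardU : ∑ S ∈ A, (1 - k S) ≤ m * t - m * K := by
    by_cases hex : ∃ S ∈ A, w' S ≠ m + 1
    · have hpos : (0 : ℝ) < m * t - m * K := by
        rw [← hU]
        obtain ⟨S, hS, hne⟩ := hex
        refine Finset.sum_pos' (fun S _ => mul_nonneg ?_ (sub_nonneg.2 (hw'.one_le S)))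
          ⟨S, hS, ?_⟩
        · simp only [k]
          split_ifs <;> simp
        · simpa [k, hne] using (hun S hS hne).2
      have h1 : K + 1 ≤ t := by
        by_contra hcon
        have : (t : ℝ) ≤ K := by exact_mod_cast (by omega : t ≤ K)
        nlinarith [Nat.cast_nonneg (α := ℝ) m]
      have h2 : ∑ S ∈ A, (1 - k S) ≤ m := by
        have : ∑ S ∈ A, (1 - k S) ≤ ∑ S ∈ A, (1 : ℝ) := Finset.sum_le_sum fun S _ => by
          simp only [k]
          split_ifs <;> simp
        refine this.trans ?_
        rw [Finset.sum_const, nsmul_one]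
        exact_mod_cast I.cover_le Finset.univ j
      have h3 : (K : ℝ) + 1 ≤ t := by exact_mod_cast h1
      nlinarith [Nat.cast_nonneg (α := ℝ) m]
    · push Not at hex
      rw [← hU]
      refine le_of_eq (Finset.sum_congr rfl fun S hS => ?_)
      simp [k, hex S hS]
  have hTA : ((t : ℕ) : ℝ) ≤ ∑ S ∈ A, a S := by
    have : ∑ S ∈ A, a S = ((A.filter fun S => S ∈ T).card : ℝ) := by
      simp only [a, Finset.sum_boole]
    rw [this]
    refine Nat.cast_le.2 (hT.trans (Finset.card_le_card fun S hS => ?_))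
    rw [Finset.mem_filter] at hS
    simp [hA, hS.1, hS.2]
  have hpot : y * (t - K) + ∑ S ∈ A, k S * u S ≤ ∑ S ∈ T, u S := by
    -- Termwise: equality holds for unsaturated sets and for saturated members of `T`, and a
    -- saturated set outside `T` needs only `u S ≤ y`.
    have h1 : ∑ S ∈ A, (y * (a S - k S) + k S * u S) ≤ ∑ S ∈ A, a S * u S := by
      refine Finset.sum_le_sum fun S hS => ?_
      have := huy S hS
      by_cases h1 : w' S = m + 1
      · by_cases h2 : S ∈ T <;> simp [a, k, h1, h2, this]
      · have := (hun S hS h1).1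
        by_cases h2 : S ∈ T <;> simp [a, k, h1, h2, this]
    have h2 : ∑ S ∈ A, a S * u S ≤ ∑ S ∈ T, u S := by
      have : ∑ S ∈ T, u S = ∑ S, a S * u S := by simp [a]
      rw [this]
      refine Finset.sum_le_sum_of_subset_of_nonneg (Finset.subset_univ _) fun S _ _ =>
        mul_nonneg ?_ (hu0 S)
      simp only [a]
      split_ifs <;> simp
    rw [Finset.sum_add_distrib, ← Finset.mul_sum, Finset.sum_sub_distrib, hκ] at h1
    have h3 : y * (t - K) ≤ y * (∑ S ∈ A, a S - K) :=
      mul_le_mul_of_nonneg_left (sub_le_sub_right hTA _) hy.le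
    linarith
  have hcost : ∑ S, I.cost S * (w' S - w S) ≤
      y * (2 * (m * t - m * K)) + (m + 1) * ∑ S ∈ A, k S * u S := by
    calc ∑ S, I.cost S * (w' S - w S) = ∑ S ∈ A, I.cost S * (w' S - w S) := by
          refine (Finset.sum_subset (Finset.subset_univ A) fun S _ hS => ?_).symm
          rw [huout S hS, sub_self, mul_zero]
      _ ≤ ∑ S ∈ A, (y * ((1 - k S) * (w' S - 1)) + y * (1 - k S) + (m + 1) * (k S * u S)) := by
          refine Finset.sum_le_sum fun S hS => ?_
          have h1 : I.cost S * (w' S - w S) ≤ w' S * u S := by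
            have := mul_le_mul_of_nonneg_left (sub_le_mul_log_sub (hwpos S) (hw'pos S))
              (I.cost_nonneg S)
            simp only [u]
            linarith
          refine h1.trans_eq ?_
          by_cases h : w' S = m + 1
          · simp [k, h]
          · simp [k, h, (hun S hS h).1]
            ring
      _ ≤ _ := by
          rw [Finset.sum_add_distrib, Finset.sum_add_distrib, ← Finset.mul_sum, ← Finset.mul_sum,
            ← Finset.mul_sum, hU]
          nlinarith
  have hm : (1 : ℝ) ≤ m := by
    have : m ≠ 0 := by
      rintro rfl
      have : A = ∅ := Finset.eq_empty_of_isEmpty A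
      simp [this] at hlt
    exact_mod_cast Nat.one_le_iff_ne_zero.2 this
  have hku : 0 ≤ ∑ S ∈ A, k S * u S := Finset.sum_nonneg fun S _ => by
    refine mul_nonneg ?_ (hu0 S)
    simp only [k]
    split_ifs <;> simp
  calc ∑ S, I.cost S * (w' S - w S) ≤ _ := hcost
    -- Uses `m + 1 ≤ 2 * m`.
    _ ≤ 2 * m * (y * (t - K) + ∑ S ∈ A, k S * u S) := by nlinarith
    _ ≤ _ := mul_le_mul_of_nonneg_left hpot (by positivity)

theorem covers_reverse {T : Finset (Fin m)} {σ : List (Fin n)} :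
    I.Covers T σ.reverse ↔ I.Covers T σ := by
  simp [Covers]

theorem Covers.of_cons {T : Finset (Fin m)} {j : Fin n} {τ : List (Fin n)}
    (h : I.Covers T (j :: τ)) : I.Covers T τ := fun k =>
  (List.count_le_count_cons (a := k) (b := j)).trans (h k)

variable (I)

open Classical in
/-- The weights of the fractional online algorithm. The elements of the sequence are listed in
reverse. -/
def weight : List (Fin n) → Fin m → ℝ
  | [] => fun S => if I.cost S = 0 then m + 1 else 1
  | j :: τ =>
    if h : ∃ w', I.IsWeightStep (weight τ) j ((j :: τ).count j) w' then h.choose else weight τ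

theorem isWeight_weight (τ : List (Fin n)) : I.IsWeight (I.weight τ) := by
  induction τ with
  | nil =>
    constructor <;> intro S <;> unfold weight <;> split_ifs <;> simp_all
  | cons j τ ih =>
    unfold weight
    split_ifs with h
    · exact h.choose_spec.isWeight
    · exact ih

theorem weight_le_cons (j : Fin n) (τ : List (Fin n)) (S : Fin m) :
    I.weight τ S ≤ I.weight (j :: τ) S := by
  rw [weight]
  split_ifs with h
  · exact h.choose_spec.le S
  · exact le_rfl

variable {I}

theorem isWeightStep_weight {C : Finset (Fin m)} {j : Fin n} {τ : List (Fin n)}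
    (hC : I.Covers C (j :: τ)) :
    I.IsWeightStep (I.weight τ) j ((j :: τ).count j) (I.weight (j :: τ)) := by
  have h := (I.isWeight_weight τ).exists_step
    ((hC j).trans (I.cover_mono (Finset.subset_univ C) j))
  rw [weight, dif_pos h]
  exact h.choose_spec

/-- The fractional online algorithm is `O(log (m + 1))`-competitive. -/
theorem cost_weight_le {C : Finset (Fin m)} {τ : List (Fin n)} (hC : I.Covers C τ) :
    ∑ S, I.cost S * (I.weight τ S - 1) ≤ 2 * m * (Real.log (m + 1) * I.totalCost C) := by
  -- The step inequalities telescope because one cover `C` of the whole sequence also covers every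
  -- prefix.
  have key : ∑ S, I.cost S * (I.weight τ S - 1) ≤
      2 * m * ∑ S ∈ C, I.cost S * Real.log (I.weight τ S) := by
    induction τ with
    | nil =>
      have h0 : ∑ S, I.cost S * (I.weight [] S - 1) = 0 := by
        refine Finset.sum_eq_zero fun S _ => ?_
        unfold weight
        split_ifs with h <;> simp [h]
      rw [h0]
      exact mul_nonneg (by positivity) (Finset.sum_nonneg fun S _ =>
        mul_nonneg (I.cost_nonneg S) (Real.log_nonneg ((I.isWeight_weight []).one_le S)))
    | cons j τ ih =>
      have h := (isWeightStep_weight hC).cost_le C (hC j)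
      have ih := ih hC.of_cons
      simp only [mul_sub, Finset.sum_sub_distrib] at h ih ⊢
      linarith
  refine key.trans (mul_le_mul_of_nonneg_left ?_ (by positivity))
  rw [totalCost, Finset.mul_sum]
  refine Finset.sum_le_sum fun S _ => ?_
  rw [mul_comm]
  have hw := I.isWeight_weight τ
  exact mul_le_mul_of_nonneg_right
    (Real.log_le_log (zero_lt_one.trans_le (hw.one_le S)) (hw.le S)) (I.cost_nonneg S)

variable (I)

/-- The fraction of each set that the fractional online algorithm has bought. -/
def frac (τ : List (Fin n)) (S : Fin m) : ℝ := (I.weight τ S - 1) / m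

theorem frac_nonneg (τ : List (Fin n)) (S : Fin m) : 0 ≤ I.frac τ S :=
  div_nonneg (sub_nonneg.2 ((I.isWeight_weight τ).one_le S)) (Nat.cast_nonneg m)

theorem frac_le_one (τ : List (Fin n)) (S : Fin m) : I.frac τ S ≤ 1 :=
  div_le_one_of_le₀ (sub_le_iff_le_add.2 ((I.isWeight_weight τ).le S)) (Nat.cast_nonneg m)

theorem frac_le_cons (j : Fin n) (τ : List (Fin n)) (S : Fin m) :
    I.frac τ S ≤ I.frac (j :: τ) S :=
  div_le_div_of_nonneg_right (sub_le_sub_right (I.weight_le_cons j τ S) 1) (Nat.cast_nonneg m)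

variable {I}

theorem count_le_sum_frac {C : Finset (Fin m)} {j : Fin n} {τ : List (Fin n)}
    (hC : I.Covers C (j :: τ)) :
    ((j :: τ).count j : ℝ) ≤ ∑ S with j ∈ I.sets S, I.frac (j :: τ) S := by
  have h := (isWeightStep_weight hC).covers
  have hm : (0 : ℝ) < m := by
    have h1 := (hC j).trans (I.cover_le C j)
    rw [List.count_cons_self] at h1
    exact_mod_cast Nat.lt_of_lt_of_le (Nat.succ_pos _) h1
  unfold frac
  rw [← Finset.sum_div, le_div_iff₀ hm, mul_comm]
  exact h

theorem cost_frac_le {C : Finset (Fin m)} {τ : List (Fin n)} (hC : I.Covers C τ) :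
    ∑ S, I.cost S * I.frac τ S ≤ 2 * Real.log (m + 1) * I.totalCost C := by
  rcases Nat.eq_zero_or_pos m with rfl | hm
  · simp [totalCost]
  have hm : (0 : ℝ) < m := by exact_mod_cast hm
  have h := cost_weight_le hC
  unfold frac
  simp only [← mul_div_assoc]
  rw [← Finset.sum_div, div_le_iff₀ hm]
  linarith

end SetCover

/-! ### Rounding by independent uniform thresholds -/

theorem unitInterval.volume_real_lt (p : ℝ) (hp : 0 ≤ p) :
    volume.real {x : unitInterval | (x : ℝ) < p} = min p 1 := by
  rcases le_or_gt p 1 with h | h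
  · have : {x : unitInterval | (x : ℝ) < p} = Set.Iio ⟨p, hp, h⟩ := rfl
    rw [this, Measure.real, unitInterval.volume_Iio, ENNReal.toReal_ofReal hp, min_eq_left h]
  · have : {x : unitInterval | (x : ℝ) < p} = Set.univ :=
      Set.eq_univ_of_forall fun x => x.2.2.trans_lt h
    rw [this, probReal_univ, min_eq_right h.le]

theorem unitInterval.measurableSet_lt (p : ℝ) : MeasurableSet {x : unitInterval | (x : ℝ) < p} :=
  measurable_subtype_coe measurableSet_Iio

/-- The indices at which the threshold is below the given level. -/
def roundSet {ι : Type*} [Fintype ι] (p : ι → ℝ) (θ : ι → unitInterval) : Finset ι :=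
  Finset.univ.filter fun i => (θ i : ℝ) < p i

/-- Fixing the thresholds once makes the rounded family grow with the fractions, so no set is given
back. -/
theorem roundSet_mono {ι : Type*} [Fintype ι] {p q : ι → ℝ} (h : ∀ i, p i ≤ q i)
    (θ : ι → unitInterval) : roundSet p θ ⊆ roundSet q θ :=
  Finset.monotone_filter_right _ fun i _ hi => lt_of_lt_of_le hi (h i)

instance Finset.instMeasurableSpaceTop {ι : Type*} : MeasurableSpace (Finset ι) := ⊤

instance {ι : Type*} : DiscreteMeasurableSpace (Finset ι) := ⟨fun _ => trivial⟩

theorem measurable_roundSet {ι : Type*} [Fintype ι] (p : ι → ℝ) : Measurable (roundSet p) := by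
  classical
  refine measurable_to_countable' fun T => ?_
  have : roundSet p ⁻¹' {T} = ⋂ i, {θ | (θ i : ℝ) < p i ↔ i ∈ T} := by
    ext θ
    simp [roundSet, Finset.ext_iff]
  rw [this]
  refine .iInter fun i => ?_
  have h : MeasurableSet {θ : ι → unitInterval | (θ i : ℝ) < p i} :=
    (measurable_pi_apply (X := fun _ : ι => unitInterval) i) (unitInterval.measurableSet_lt (p i))
  by_cases hi : i ∈ T
  · simpa only [hi, iff_true] using h
  · simp only [hi, iff_false]
    exact h.compl

theorem integrable_comp_finset {Ω ι : Type*} [MeasurableSpace Ω] {μ : Measure Ω}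
    [IsFiniteMeasure μ] [Finite ι] {g : Ω → Finset ι} (hg : Measurable g) (f : Finset ι → ℝ) :
    Integrable (fun ω => f (g ω)) μ := by
  have hf : Measurable f := .of_discrete
  obtain ⟨c, hc⟩ := (Set.finite_range fun T => ‖f T‖).bddAbove
  exact .of_bound (hf.comp hg).aestronglyMeasurable c (.of_forall fun ω => hc ⟨_, rfl⟩)

theorem integral_sum_roundSet_le {ι : Type*} [Fintype ι] {p c : ι → ℝ} (hp : ∀ i, 0 ≤ p i)
    (hc : ∀ i, 0 ≤ c i) :
    ∫ θ : ι → unitInterval, ∑ i ∈ roundSet p θ, c i ≤ ∑ i, c i * p i := by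
  have h1 : ∀ θ : ι → unitInterval, ∑ i ∈ roundSet p θ, c i =
      ∑ i, {x : unitInterval | (x : ℝ) < p i}.indicator (fun _ => c i) (θ i) := by
    intro θ
    rw [roundSet, Finset.sum_filter]
    rfl
  have hmeas : ∀ i, MeasurePreserving (fun θ : ι → unitInterval => θ i) volume volume :=
    fun i => measurePreserving_eval (fun _ : ι => (volume : Measure unitInterval)) i
  have hint : ∀ i, Integrable
      ({x : unitInterval | (x : ℝ) < p i}.indicator fun _ => c i) volume := fun i =>
    (integrable_const (c i)).indicator (unitInterval.measurableSet_lt _)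
  simp only [h1]
  rw [integral_finsetSum _ fun i _ => by
    exact (hmeas i).integrable_comp_of_integrable (hint i)]
  refine Finset.sum_le_sum fun i _ => ?_
  have h2 : ∫ θ : ι → unitInterval,
      {x : unitInterval | (x : ℝ) < p i}.indicator (fun _ => c i) (θ i) =
      ∫ x : unitInterval, {x : unitInterval | (x : ℝ) < p i}.indicator (fun _ => c i) x := by
    rw [← (hmeas i).map_eq, integral_map (hmeas i).measurable.aemeasurable]
    rw [(hmeas i).map_eq]
    exact (hint i).aestronglyMeasurable
  rw [h2, integral_indicator_const _ (unitInterval.measurableSet_lt _),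
    unitInterval.volume_real_lt _ (hp i), smul_eq_mul, mul_comm]
  exact mul_le_mul_of_nonneg_left (min_le_left _ _) (hc i)

/-- By independence the expectation factors; an index of `A`, chosen with probability `min p 1`,
contributes the mean of `1/2` and `1`. This is the generating function for the Chernoff-type bound
below. -/
theorem integral_half_pow_roundSet {ι : Type*} [Fintype ι] [DecidableEq ι]
    {p : ι → ℝ} (hp : ∀ i, 0 ≤ p i)
    (A : Finset ι) :
    ∫ θ : ι → unitInterval, (1 / 2 : ℝ) ^ ((roundSet p θ).filter (· ∈ A)).card =
      ∏ i ∈ A, (1 - min (p i) 1 / 2) := by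
  let f (i : ι) (x : unitInterval) : ℝ :=
    1 + ({x : unitInterval | (x : ℝ) < p i}.indicator (fun _ => if i ∈ A then -(1 / 2) else 0) x)
  have h1 : ∀ θ : ι → unitInterval,
      (1 / 2 : ℝ) ^ ((roundSet p θ).filter (· ∈ A)).card = ∏ i, f i (θ i) := by
    intro θ
    rw [← Finset.prod_const, roundSet, Finset.filter_filter, Finset.prod_filter]
    refine Finset.prod_congr rfl fun i _ => ?_
    by_cases h1 : (θ i : ℝ) < p i <;> by_cases h2 : i ∈ A <;> simp [f, h1, h2]
    norm_num
  simp only [h1]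
  rw [integral_fintype_prod_volume_eq_prod, ← Finset.prod_subset (Finset.subset_univ A)]
  · refine Finset.prod_congr rfl fun i hi => ?_
    simp only [f]
    rw [integral_add (integrable_const _)
      ((integrable_const _).indicator (unitInterval.measurableSet_lt _)),
      integral_indicator_const _ (unitInterval.measurableSet_lt _),
      unitInterval.volume_real_lt _ (hp i)]
    simp [hi]
    ring
  · intro i _ hi
    simp [f, hi]

/-- Independent rounding of a fractional cover, scaled up logarithmically, seldom fails. -/
theorem measureReal_roundSet_lt_le {ι : Type*} [Fintype ι] [DecidableEq ι]
    {x : ι → ℝ} (hx : ∀ i, 0 ≤ x i)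
    (hx1 : ∀ i, x i ≤ 1) {A : Finset ι} {t : ℕ} (ht : t ≤ ∑ i ∈ A, x i) {D : ℝ} (hD : 1 ≤ D) :
    volume.real {θ : ι → unitInterval |
      ((roundSet (fun i => (2 * Real.log D + 2) * x i) θ).filter (· ∈ A)).card < t} ≤ 1 / D := by
  have hlog : 0 ≤ Real.log D := Real.log_nonneg hD
  have hD0 : 0 < D := zero_lt_one.trans_le hD
  set α : ℝ := 2 * Real.log D + 2 with hα
  have hp : ∀ i, 0 ≤ α * x i := fun i => mul_nonneg (by positivity) (hx i)
  set N : (ι → unitInterval) → ℕ := fun θ =>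
    ((roundSet (fun i => α * x i) θ).filter (· ∈ A)).card with hN
  -- These indices are chosen with certainty, as thresholds are at most `1`. If they already number
  -- `t`, rounding cannot fail.
  set K := A.filter fun i => 1 < α * x i
  have hKN : ∀ θ, K.card ≤ N θ := fun θ => Finset.card_le_card fun i hi => by
    rw [Finset.mem_filter] at hi
    simp only [roundSet, Finset.mem_filter, Finset.mem_univ, true_and]
    exact ⟨(θ i).2.2.trans_lt hi.2, hi.1⟩
  rcases le_or_gt t K.card with htK | htK
  · have : {θ | N θ < t} = ∅ := Set.eq_empty_of_forall_notMem fun θ hθ =>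
      absurd (lt_of_lt_of_le hθ htK) (not_lt.2 (hKN θ))
    change volume.real {θ | N θ < t} ≤ _
    rw [this, measureReal_empty]
    positivity
  have hint : Integrable (fun θ => (1 / 2 : ℝ) ^ N θ) volume :=
    integrable_comp_finset (measurable_roundSet _) fun T => (1 / 2 : ℝ) ^ (T.filter (· ∈ A)).card
  -- Markov's inequality for `(1/2) ^ N`, which is at least `(1/2) ^ t` whenever rounding fails.
  have hmarkov := mul_meas_ge_le_integral_of_nonneg (.of_forall fun θ => by positivity) hint
    ((1 / 2 : ℝ) ^ t)
  rw [integral_half_pow_roundSet hp] at hmarkov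
  have hsub : volume.real {θ | N θ < t} ≤ volume.real {θ | (1 / 2 : ℝ) ^ t ≤ (1 / 2 : ℝ) ^ N θ} :=
    measureReal_mono fun θ (hθ : N θ < t) =>
      show (1 / 2 : ℝ) ^ t ≤ (1 / 2 : ℝ) ^ N θ from
        pow_le_pow_of_le_one (by norm_num) (by norm_num) hθ.le
  -- Certain indices contribute `1/2` each; the others have total fraction at least `t - K.card`,
  -- since each `x i ≤ 1`.
  have hprod : ∏ i ∈ A, (1 - min (α * x i) 1 / 2) ≤
      (1 / 2 : ℝ) ^ K.card * Real.exp (-(α / 2 * (t - K.card))) := by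
    rw [← Finset.prod_filter_mul_prod_filter_not A fun i => 1 < α * x i]
    refine mul_le_mul ?_ ?_ ?_ (by positivity)
    · rw [← Finset.prod_const]
      refine le_of_eq (Finset.prod_congr rfl fun i hi => ?_)
      rw [min_eq_right (Finset.mem_filter.1 hi).2.le]
      norm_num
    · calc ∏ i ∈ A with ¬ 1 < α * x i, (1 - min (α * x i) 1 / 2)
          ≤ ∏ i ∈ A with ¬ 1 < α * x i, Real.exp (-(α / 2 * x i)) := by
            refine Finset.prod_le_prod (fun i _ => ?_) fun i hi => ?_
            · have := min_le_right (α * x i) 1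
              linarith
            · rw [min_eq_left (not_lt.1 (Finset.mem_filter.1 hi).2)]
              have := Real.add_one_le_exp (-(α / 2 * x i))
              linarith
        _ = Real.exp (-(α / 2 * ∑ i ∈ A with ¬ 1 < α * x i, x i)) := by
            rw [← Real.exp_sum, Finset.sum_neg_distrib, Finset.mul_sum]
        _ ≤ _ := by
            refine Real.exp_le_exp.2 (neg_le_neg (mul_le_mul_of_nonneg_left ?_ (by positivity)))
            have h1 := Finset.sum_filter_add_sum_filter_not A (fun i => 1 < α * x i) x
            have h2 : ∑ i ∈ A with 1 < α * x i, x i ≤ K.card := by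
              simpa using Finset.sum_le_card_nsmul K x 1 fun i _ => hx1 i
            linarith
    · refine Finset.prod_nonneg fun i _ => ?_
      have := min_le_right (α * x i) 1
      linarith
  -- As `α / 2 = log D + 1`, the failure bound is `(2 / (e D)) ^ (k + 1)`; the exponent is at least
  -- one, so this is at most `1 / D`.
  obtain ⟨k, rfl⟩ : ∃ k, t = K.card + (k + 1) := ⟨t - K.card - 1, by omega⟩
  have h2 : Real.exp (-(α / 2 * ((K.card + (k + 1) : ℕ) - K.card))) ≤
      (1 / 2 : ℝ) ^ (k + 1) * (1 / D) := by
    have h3 : -(α / 2 * (((K.card + (k + 1) : ℕ) : ℝ) - K.card)) =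
        ((k + 1 : ℕ) : ℝ) * (-1 + -Real.log D) := by
      rw [hα]
      push_cast
      ring
    have h4 : Real.exp (-1) ≤ 1 / 2 := by
      rw [Real.exp_neg, ← one_div]
      exact one_div_le_one_div_of_le two_pos (by linarith [Real.add_one_le_exp 1])
    have h5 : Real.exp (-Real.log D) = 1 / D := by
      rw [Real.exp_neg, Real.exp_log hD0, one_div]
    rw [h3, Real.exp_nat_mul, Real.exp_add, h5, mul_pow]
    refine mul_le_mul (pow_le_pow_left₀ (Real.exp_pos _).le h4 _) ?_ (by positivity) (by positivity)
    exact pow_le_of_le_one (by positivity) (by rw [div_le_one hD0]; exact hD) (Nat.succ_ne_zero k)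
  have h6 : (1 / 2 : ℝ) ^ (K.card + (k + 1)) * volume.real {θ | N θ < K.card + (k + 1)} ≤
      (1 / 2 : ℝ) ^ (K.card + (k + 1)) * (1 / D) :=
    calc _ ≤ _ := mul_le_mul_of_nonneg_left hsub (by positivity)
      _ ≤ _ := hmarkov
      _ ≤ _ := hprod
      _ ≤ (1 / 2 : ℝ) ^ K.card * ((1 / 2 : ℝ) ^ (k + 1) * (1 / D)) :=
        mul_le_mul_of_nonneg_left h2 (by positivity)
      _ = _ := by ring
  exact le_of_mul_le_mul_left h6 (by positivity)

/-! ### Repairs and the competitive ratios -/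

namespace SetCover

variable {n m : ℕ} (I : SetCover n m)

open Classical in
/-- A cheapest set outside `T` that contains `j`, in case `T` covers `j` less than `t` times. -/
def repair (j : Fin n) (t : ℕ) (T : Finset (Fin m)) : Finset (Fin m) :=
  if h : I.cover T j < t ∧ ∃ S, (S ∉ T ∧ j ∈ I.sets S) ∧
      ∀ S', S' ∉ T ∧ j ∈ I.sets S' → I.cost S ≤ I.cost S' then {h.2.choose} else ∅

variable {I}

theorem repair_eq_empty {j : Fin n} {t : ℕ} {T : Finset (Fin m)} (h : t ≤ I.cover T j) :
    I.repair j t T = ∅ :=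
  dif_neg fun h' => absurd h'.1 (not_lt.2 h)

/-- A cover `C` contains more sets through `j` than `T` does, hence one outside `T`; the cheapest
candidate costs no more than that one. -/
theorem repair_spec {j : Fin n} {t : ℕ} {T C : Finset (Fin m)} (h : I.cover T j < t)
    (hC : t ≤ I.cover C j) : ∃ S ∉ T, j ∈ I.sets S ∧ I.repair j t T = {S} ∧
      I.cost S ≤ I.totalCost C := by
  obtain ⟨S', hS', hS'T⟩ : ∃ S' ∈ C.filter fun S => j ∈ I.sets S, S' ∉ T := by
    by_contra hno
    push Not at hno
    refine absurd (h.trans_le hC) (not_lt.2 (Finset.card_le_card fun S hS => ?_))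
    exact Finset.mem_filter.2 ⟨hno S hS, (Finset.mem_filter.1 hS).2⟩
  rw [Finset.mem_filter] at hS'
  have hex : ∃ S, (S ∉ T ∧ j ∈ I.sets S) ∧
      ∀ S', S' ∉ T ∧ j ∈ I.sets S' → I.cost S ≤ I.cost S' :=
    Set.exists_min_image {S | S ∉ T ∧ j ∈ I.sets S} I.cost (Set.toFinite _)
      ⟨S', hS'T, hS'.2⟩
  have hspec := hex.choose_spec
  exact ⟨hex.choose, hspec.1.1, hspec.1.2, dif_pos ⟨h, hex⟩,
    (hspec.2 S' ⟨hS'T, hS'.2⟩).trans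
      (Finset.single_le_sum (fun S _ => I.cost_nonneg S) hS'.1)⟩

/-- A single set suffices, because before the arrival `j` was already covered `t - 1` times. -/
theorem le_cover_union_repair {j : Fin n} {t : ℕ} {T C : Finset (Fin m)}
    (hC : t ≤ I.cover C j) (h : t ≤ I.cover T j + 1) : t ≤ I.cover (T ∪ I.repair j t T) j := by
  rcases le_or_gt t (I.cover T j) with hle | hlt
  · exact hle.trans (I.cover_mono Finset.subset_union_left j)
  · obtain ⟨S, hST, hjS, hrep, -⟩ := repair_spec hlt hC
    refine h.trans_eq ?_
    rw [hrep, Finset.union_comm, ← Finset.insert_eq, cover, cover, Finset.filter_insert,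
      if_pos hjS, Finset.card_insert_of_notMem fun h => hST (Finset.mem_filter.1 h).1]

variable (I) (D : ℝ)

/-- The sets bought by rounding the fractional solution. -/
def rounded (τ : List (Fin n)) (θ : Fin m → unitInterval) : Finset (Fin m) :=
  roundSet (fun S => (2 * Real.log D + 2) * I.frac τ S) θ

/-- The sets bought because rounding has failed. -/
def repairs : List (Fin n) → (Fin m → unitInterval) → Finset (Fin m)
  | [], _ => ∅
  | j :: τ, θ => repairs τ θ ∪
      I.repair j ((j :: τ).count j) (I.rounded D (j :: τ) θ ∪ repairs τ θ)

variable {I D}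

theorem rounded_subset_cons (hD : 1 ≤ D) (j : Fin n) (τ : List (Fin n))
    (θ : Fin m → unitInterval) : I.rounded D τ θ ⊆ I.rounded D (j :: τ) θ := by
  have := Real.log_nonneg hD
  exact roundSet_mono
    (fun S => mul_le_mul_of_nonneg_left (I.frac_le_cons j τ S) (by positivity)) θ

theorem covers_rounded_union_repairs (hD : 1 ≤ D) {C : Finset (Fin m)} {τ : List (Fin n)}
    (hC : I.Covers C τ) (θ : Fin m → unitInterval) :
    I.Covers (I.rounded D τ θ ∪ I.repairs D τ θ) τ := by
  induction τ with
  | nil => exact fun j => by simp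
  | cons j τ ih =>
    intro k
    have h1 : τ.count k ≤ I.cover (I.rounded D (j :: τ) θ ∪ I.repairs D τ θ) k :=
      (ih hC.of_cons k).trans (I.cover_mono
        (Finset.union_subset_union (rounded_subset_cons hD j τ θ) le_rfl) k)
    rw [repairs, ← Finset.union_assoc]
    rcases eq_or_ne j k with rfl | hne
    · refine le_cover_union_repair (hC j) ?_
      rw [List.count_cons_self]
      omega
    · rw [List.count_cons_of_ne hne]
      exact h1.trans (I.cover_mono Finset.subset_union_left k)

theorem measurable_rounded (τ : List (Fin n)) : Measurable (I.rounded D τ) :=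
  measurable_roundSet _

theorem measurable_repairs (τ : List (Fin n)) : Measurable (I.repairs D τ) := by
  induction τ with
  | nil => exact measurable_const
  | cons j τ ih =>
    let g (X : Finset (Fin m) × Finset (Fin m)) : Finset (Fin m) :=
      X.2 ∪ I.repair j ((j :: τ).count j) (X.1 ∪ X.2)
    have hg : Measurable g := .of_discrete
    have h : I.repairs D (j :: τ) = fun θ => g (I.rounded D (j :: τ) θ, I.repairs D τ θ) := by
      funext θ
      rw [repairs]
    rw [h]
    exact hg.comp ((measurable_rounded (j :: τ)).prodMk ih)

/-- The upper bound `M` for the cost of each repair holds throughout the sequence. -/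
def RepairCostLE (I : SetCover n m) (M : ℝ) : List (Fin n) → Prop
  | [] => True
  | j :: τ => RepairCostLE I M τ ∧ ∀ T, I.totalCost (I.repair j ((j :: τ).count j) T) ≤ M

theorem repairCostLE_of_forall {M : ℝ} {C : Finset (Fin m)} {τ : List (Fin n)}
    (hC : I.Covers C τ) (hM0 : 0 ≤ M)
    (hM : (∀ S, I.cost S ≤ M) ∨ I.totalCost C ≤ M) : I.RepairCostLE M τ := by
  induction τ with
  | nil => trivial
  | cons j τ ih =>
    refine ⟨ih hC.of_cons, fun T => ?_⟩
    rcases le_or_gt ((j :: τ).count j) (I.cover T j) with h | h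
    · rw [repair_eq_empty h]
      simpa [totalCost] using hM0
    · obtain ⟨S, -, -, hrep, hS⟩ := repair_spec h (hC j)
      rw [hrep, totalCost, Finset.sum_singleton]
      exact hM.elim (fun hM => hM S) hS.trans

theorem totalCost_union_le (T T' : Finset (Fin m)) :
    I.totalCost (T ∪ T') ≤ I.totalCost T + I.totalCost T' := by
  have h := Finset.sum_union_inter (s₁ := T) (s₂ := T') (f := I.cost)
  have h' := I.totalCost_nonneg (T ∩ T')
  unfold totalCost at *
  linarith

/-- Each arrival triggers a repair only if rounding alone fails, which has probability at most `1 /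
D`. Linearity of expectation over arrivals suffices, so dependence between the failures does not
matter. -/
theorem integral_totalCost_repairs_le (hD : 1 ≤ D) {M : ℝ} (hM0 : 0 ≤ M) {C : Finset (Fin m)}
    {τ : List (Fin n)} (hC : I.Covers C τ) (hM : I.RepairCostLE M τ) :
    ∫ θ, I.totalCost (I.repairs D τ θ) ≤ τ.length * (M / D) := by
  induction τ with
  | nil => simp [repairs, totalCost]
  | cons j τ ih =>
    let F : Set (Fin m → unitInterval) :=
      {θ | I.cover (I.rounded D (j :: τ) θ) j < (j :: τ).count j}
    have hF : MeasurableSet F :=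
      measurable_rounded (j :: τ)
        (show MeasurableSet {T | I.cover T j < (j :: τ).count j} from .of_discrete)
    have hFD : volume.real F ≤ 1 / D := by
      refine (measureReal_mono fun θ hθ => ?_).trans (measureReal_roundSet_lt_le
        (I.frac_nonneg (j :: τ)) (I.frac_le_one (j :: τ)) (count_le_sum_frac hC) hD)
      simpa [F, cover, rounded] using hθ
    have hle : ∀ θ, I.totalCost (I.repairs D (j :: τ) θ) ≤
        I.totalCost (I.repairs D τ θ) + F.indicator (fun _ => M) θ := by
      intro θ
      refine (totalCost_union_le _ _).trans (add_le_add le_rfl ?_)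
      by_cases hθ : θ ∈ F
      · rw [Set.indicator_of_mem hθ]
        exact hM.2 _
      · rw [Set.indicator_of_notMem hθ, repair_eq_empty]
        · simp [totalCost]
        · exact (not_lt.1 hθ).trans (I.cover_mono Finset.subset_union_left j)
    have hint := integrable_comp_finset (μ := volume) (measurable_repairs (I := I) (D := D) τ)
      I.totalCost
    calc ∫ θ, I.totalCost (I.repairs D (j :: τ) θ)
        ≤ ∫ θ, (I.totalCost (I.repairs D τ θ) + F.indicator (fun _ => M) θ) :=
          integral_mono (integrable_comp_finset (measurable_repairs _) I.totalCost)
            (hint.add ((integrable_const M).indicator hF)) hle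
      _ = (∫ θ, I.totalCost (I.repairs D τ θ)) + volume.real F * M := by
          rw [integral_add hint ((integrable_const M).indicator hF), integral_indicator_const _ hF,
            smul_eq_mul]
      _ ≤ τ.length * (M / D) + 1 / D * M :=
          add_le_add (ih hC.of_cons hM.1) (mul_le_mul_of_nonneg_right hFD hM0)
      _ = (j :: τ).length * (M / D) := by
          rw [List.length_cons]
          push_cast
          ring

variable (I) in
/-- The online algorithm that rounds the fractional solution by independent random thresholds,
and that repairs the failures. -/
def roundAlgorithm (hD : 1 ≤ D) : I.RandAlgorithm where
  Ω := Fin m → unitInterval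
  μ := volume
  alg θ :=
    { chosen := fun σ => I.rounded D σ.reverse θ ∪ I.repairs D σ.reverse θ
      mono := fun σ j => by
        rw [List.reverse_append]
        exact Finset.union_subset_union (rounded_subset_cons hD j _ θ) Finset.subset_union_left
      covers := fun σ ⟨_, hC⟩ =>
        covers_reverse.1 (covers_rounded_union_repairs hD (covers_reverse.2 hC) θ) }
  measurable_chosen σ T := by
    have h : Measurable fun X : Finset (Fin m) × Finset (Fin m) => X.1 ∪ X.2 := .of_discrete
    exact (h.comp ((measurable_rounded (I := I) (D := D) σ.reverse).prodMk
      (measurable_repairs σ.reverse))) (measurableSet_singleton T)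

theorem expCost_roundAlgorithm_le (hD : 1 ≤ D) {σ : List (Fin n)} {C : Finset (Fin m)}
    (hC : I.Covers C σ) {M : ℝ} (hM0 : 0 ≤ M) (hM : (∀ S, I.cost S ≤ M) ∨ I.totalCost C ≤ M) :
    (I.roundAlgorithm hD).expCost σ ≤
      4 * (Real.log D + 1) * Real.log (m + 1) * I.totalCost C + σ.length * (M / D) := by
  have hC' := covers_reverse.2 hC
  have hlog := Real.log_nonneg hD
  have hint₁ := integrable_comp_finset (μ := volume)
    (measurable_rounded (I := I) (D := D) σ.reverse) I.totalCost
  have hint₂ := integrable_comp_finset (μ := volume)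
    (measurable_repairs (I := I) (D := D) σ.reverse) I.totalCost
  calc (I.roundAlgorithm hD).expCost σ
      ≤ ∫ θ, (I.totalCost (I.rounded D σ.reverse θ) + I.totalCost (I.repairs D σ.reverse θ)) :=
        integral_mono_of_nonneg (.of_forall fun θ => I.totalCost_nonneg _) (hint₁.add hint₂)
          (.of_forall fun θ => totalCost_union_le _ _)
    _ = (∫ θ, I.totalCost (I.rounded D σ.reverse θ)) +
          ∫ θ, I.totalCost (I.repairs D σ.reverse θ) := integral_add hint₁ hint₂
    _ ≤ ∑ S, I.cost S * ((2 * Real.log D + 2) * I.frac σ.reverse S) +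
          σ.reverse.length * (M / D) :=
        add_le_add (integral_sum_roundSet_le
          (fun S => mul_nonneg (by positivity) (I.frac_nonneg _ S)) I.cost_nonneg)
          (integral_totalCost_repairs_le hD hM0 hC' (repairCostLE_of_forall hC' hM0 hM))
    _ = (2 * Real.log D + 2) * ∑ S, I.cost S * I.frac σ.reverse S + σ.length * (M / D) := by
        rw [List.length_reverse, Finset.mul_sum]
        congr 1
        exact Finset.sum_congr rfl fun S _ => by ring
    _ ≤ (2 * Real.log D + 2) * (2 * Real.log (m + 1) * I.totalCost C) + σ.length * (M / D) :=
        add_le_add (mul_le_mul_of_nonneg_left (cost_frac_le hC') (by positivity)) le_rfl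
    _ = _ := by ring

theorem length_le_mul_of_count_le {σ : List (Fin n)} {b : ℕ} (hb : ∀ j, σ.count j ≤ b) :
    σ.length ≤ n * b := by
  have h : σ.length = ∑ j, σ.count j := by
    rw [← Multiset.coe_card, ← Multiset.sum_count_eq_card (s := Finset.univ) (by simp)]
    simp
  rw [h]
  refine (Finset.sum_le_sum fun j _ => hb j).trans ?_
  simp

theorem one_le_two_mul_log {x : ℝ} (hx : 2 ≤ x) : 1 ≤ 2 * Real.log x := by
  have h1 := Real.log_two_gt_d9
  have h2 := Real.log_le_log two_pos hx
  linarith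

theorem Coverable.eq_nil {σ : List (Fin n)} (hσ : I.Coverable σ)
    (h : n = 0 ∨ m = 0) : σ = [] := by
  rcases h with rfl | rfl
  · cases σ with
    | nil => rfl
    | cons j _ => exact j.elim0
  · obtain ⟨C, hC⟩ := hσ
    cases σ with
    | nil => rfl
    | cons j σ =>
      have := (hC j).trans (I.cover_le C j)
      simp at this

theorem opt_nil : I.opt [] = 0 := by
  obtain ⟨C, hC, h⟩ := I.exists_totalCost_eq_opt (σ := []) ⟨∅, fun j => by simp⟩
  exact le_antisymm (by simpa [totalCost] using I.opt_le (σ := []) (T := ∅) fun j => by simp)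
    (h ▸ I.totalCost_nonneg C)

theorem isCompetitive_of_unit_cost (hc : ∀ S, I.cost S = 1) :
    (I.roundAlgorithm (D := n + 1) (by simp)).IsCompetitive
      (16 * (Real.log ((m : ℝ) + 1) * Real.log ((n : ℝ) + 1))) := by
  intro σ hσ
  obtain ⟨C, hC, hopt⟩ := I.exists_totalCost_eq_opt hσ
  have hcost : I.totalCost C = C.card := by simp [totalCost, hc]
  have h := expCost_roundAlgorithm_le (D := (n : ℝ) + 1) (by simp) hC zero_le_one
    (.inl fun S => (hc S).le)
  rw [← hopt]
  by_cases h0 : n = 0 ∨ m = 0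
  · have hσ0 := hσ.eq_nil h0
    subst hσ0
    have : I.totalCost C = 0 := hopt.trans opt_nil
    simpa [this] using h
  push Not at h0
  have hn : (1 : ℝ) ≤ n := by exact_mod_cast Nat.one_le_iff_ne_zero.2 h0.1
  have hm : (1 : ℝ) ≤ m := by exact_mod_cast Nat.one_le_iff_ne_zero.2 h0.2
  have hln := one_le_two_mul_log (x := (n : ℝ) + 1) (by linarith)
  have hlm := one_le_two_mul_log (x := (m : ℝ) + 1) (by linarith)
  -- Each element arrives at most `C.card = opt` times, so there are at most `n * opt` repairs of
  -- cost `1`, each with probability at most `1 / (n + 1)`.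
  have hlen : (σ.length : ℝ) * (1 / (n + 1)) ≤ I.totalCost C := by
    have h1 : σ.length ≤ n * C.card := length_le_mul_of_count_le fun j =>
      (hC j).trans (Finset.card_filter_le _ _)
    have h2 : (σ.length : ℝ) ≤ n * C.card := by exact_mod_cast h1
    rw [hcost, mul_one_div, div_le_iff₀ (by positivity)]
    nlinarith [Nat.cast_nonneg (α := ℝ) C.card]
  have hopt0 := I.totalCost_nonneg C
  refine h.trans ((add_le_add le_rfl hlen).trans ?_)
  set a := Real.log ((n : ℝ) + 1)
  set b := Real.log ((m : ℝ) + 1)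
  -- Both logarithms are at least `1/2`, so `4 * b ≤ 8 * a * b` and `1 ≤ 4 * a * b`; this is where
  -- `16` comes from.
  have h3 : 4 * (a + 1) * b + 1 ≤ 16 * (b * a) := by nlinarith
  nlinarith

theorem isCompetitive_of_cost_nonneg :
    (I.roundAlgorithm (D := m * n + 1) (by simp; positivity)).IsCompetitive
      (16 * Real.log ((m : ℝ) * (n : ℝ) + 1) ^ 2) := by
  intro σ hσ
  obtain ⟨C, hC, hopt⟩ := I.exists_totalCost_eq_opt hσ
  have hopt0 := I.totalCost_nonneg C
  have h := expCost_roundAlgorithm_le (D := (m : ℝ) * n + 1) (by simp; positivity) hC hopt0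
    (.inr le_rfl)
  rw [← hopt]
  by_cases h0 : n = 0 ∨ m = 0
  · have hσ0 := hσ.eq_nil h0
    subst hσ0
    have : I.totalCost C = 0 := hopt.trans opt_nil
    simpa [this] using h
  push Not at h0
  have hn : (1 : ℝ) ≤ n := by exact_mod_cast Nat.one_le_iff_ne_zero.2 h0.1
  have hm : (1 : ℝ) ≤ m := by exact_mod_cast Nat.one_le_iff_ne_zero.2 h0.2
  have hmn : (m : ℝ) ≤ m * n := le_mul_of_one_le_right (by linarith) hn
  have hln := one_le_two_mul_log (x := (m : ℝ) * n + 1) (by linarith)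
  have hlm : Real.log ((m : ℝ) + 1) ≤ Real.log ((m : ℝ) * n + 1) :=
    Real.log_le_log (by linarith) (by linarith)
  have hlm0 : 0 ≤ Real.log ((m : ℝ) + 1) := Real.log_nonneg (by linarith)
  -- Here a repair costs at most the optimum, and a coverable sequence has at most `n * m` arrivals,
  -- which the factor `1 / (m * n + 1)` absorbs.
  have hlen : (σ.length : ℝ) * (I.totalCost C / (m * n + 1)) ≤ I.totalCost C := by
    have h1 : σ.length ≤ n * m := length_le_mul_of_count_le fun j => (hC j).trans (I.cover_le C j)
    have h2 : (σ.length : ℝ) ≤ n * m := by exact_mod_cast h1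
    rw [← mul_div_assoc, div_le_iff₀ (by positivity)]
    nlinarith
  refine h.trans ((add_le_add le_rfl hlen).trans ?_)
  set a := Real.log ((m : ℝ) * n + 1)
  set b := Real.log ((m : ℝ) + 1)
  have h3 : 4 * (a + 1) * b + 1 ≤ 16 * a ^ 2 := by nlinarith
  nlinarith

end SetCover

end

theorem mainTheorem3 :
    -- the reduction to `n` edges with capacities at most `m`, requests being sets of edges
    (∀ (n m : ℕ) (I : SetCover n m), (∀ S, 0 < I.cost S) →
      (0 < m → ∀ j, I.network.cap j ≤ m) ∧
      I.ReducesTo I.sets (fun j => {j}) I.network) ∧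
    -- the same with extra edges, so that all requests are simple paths in a directed graph
    (∀ (n m : ℕ) (I : SetCover n m), (∀ S, 0 < I.cost S) →
      ∃ (V : Type) (_ : Finite V) (G : Digraph V) (N : Network G.Edge)
        (edge : Fin n → G.Edge) (path : Fin m → Finset G.Edge),
        Function.Injective edge ∧
        Nat.card G.Edge ≤ 3 * n ∧
        (0 < m → ∀ e, N.cap e ≤ m) ∧
        (∀ j, N.cap (edge j) = I.network.cap j) ∧
        (∀ S, G.IsSimplePath (path S)) ∧
        (∀ S j, edge j ∈ path S ↔ j ∈ I.sets S) ∧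
        (∀ j, G.IsSimplePath {edge j}) ∧
        I.ReducesTo path (fun j => {edge j}) N) ∧
    -- unit costs
    (∃ C : ℝ, 0 < C ∧ ∀ (n m : ℕ) (I : SetCover n m), (∀ S, I.cost S = 1) →
      ∃ B : I.RandAlgorithm,
        B.IsCompetitive (C * (Real.log ((m : ℝ) + 1) * Real.log ((n : ℝ) + 1)))) ∧
    -- arbitrary costs
    (∃ C : ℝ, 0 < C ∧ ∀ (n m : ℕ) (I : SetCover n m),
      ∃ B : I.RandAlgorithm,
        B.IsCompetitive (C * Real.log ((m : ℝ) * (n : ℝ) + 1) ^ 2)) := by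
  refine ⟨fun n m I _ => ⟨SetCover.network_cap_le, SetCover.models_network.reducesTo⟩,
    fun n m I _ => ⟨Fin (2 * n + 1), inferInstance, shortcutDigraph n,
      shortcutDigraph.network I, shortcutDigraph.edge,
      fun S => shortcutDigraph.path (I.sets S), shortcutDigraph.edge_injective,
      shortcutDigraph.card_edge_le n, shortcutDigraph.network_cap_le I,
      shortcutDigraph.network_cap_edge I, fun S => shortcutDigraph.isSimplePath_path _,
      fun S j => shortcutDigraph.edge_mem_path, fun j => ?_,
      (shortcutDigraph.models I).reducesTo⟩,
    ⟨16, by norm_num, fun n m I hc => ⟨_, SetCover.isCompetitive_of_unit_cost hc⟩⟩,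
    ⟨16, by norm_num, fun n m I => ⟨_, SetCover.isCompetitive_of_cost_nonneg⟩⟩⟩
  refine shortcutDigraph.isSimplePath_singleton _ fun h => ?_
  have := congrArg Fin.val h
  simp [shortcutDigraph.edge, shortcutDigraph.vertex] at this
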